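/- Let $\mathcal T$ be a triangulation formed from $n$ tetrahedra by affinely gluing some or all of their $4n$ faces in pairs (in particular, any 3-manifold triangulation), and let $f$ be the number of non-boundary faces. Each tetrahedron has seven types of normal disc (four triangle types and three quadrilateral types), giving $7n$ coordinates. The vector representation $\mathbf v(S)\in\mathbb Z^{7n}$ of a normal surface $S$ counts its discs of each type. Let $A$ be the $3f\times 7n$ matrix of the matching equations, which state that for each non-boundary face and each vertex of it the normal arcs around that vertex coming from the two sides are equal in number, with its rows arranged in an arbitrary order. A vector $\mathbf x\in\mathbb Z^{7n}$ satisfies the quadrilateral constraints if for each tetrahedron at most one of its three quadrilateral coordinates is non-zero. For $0\le k\le 3f$ let $$\mathscr P^{(k)}=\{\mathbf x\in\mathbb R^{7n}\mid \mathbf x\ge 0,\ \text{the first } k \text{ rows of } A \text{ vanish on } \mathbf x\},$$ and let $\mathrm{Hilb}(\mathscr P^{(k)})$ be its Hilbert basis, that is, the set of all non-zero integer points of $\mathscr P^{(k)}$ that are not a sum of two non-zero integer points of $\mathscr P^{(k)}$. A fundamental normal surface is a normal surface $S$ with $\mathbf v(S)\neq 0$ such that $\mathbf v(S)=\mathbf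 v(U)+\mathbf v(V)$ for normal surfaces $U,V$ implies $\mathbf v(U)=0$ or $\mathbf v(V)=0$. Consider the following algorithm. Let $B^{(0)}$ be the set of unit vectors in $\mathbb R^{7n}$. For $i=1,\dots,3f$, let $\mathbf h$ be the $i$th row of $A$, and compute $B^{(i)}$ from $B^{(i-1)}$ as follows. 1. Let $B_+=\{\mathbf x\in B^{(i-1)}\mid \mathbf h\cdot\mathbf x\ge 0\}$ and $B_-=\{\mathbf x\in B^{(i-1)}\mid \mathbf h\cdot\mathbf x\le 0\}$. 2. (Expansion) For all $\mathbf x\in B_+$, $\mathbf y\in B_-$ with $\mathbf h\cdot\mathbf x>0>\mathbf h\cdot\mathbf y$ for which $\mathbf x+\mathbf y$ satisfies the quadrilateral constraints, insert $\mathbf x+\mathbf y$ into $B_+$ if $\mathbf h\cdot(\mathbf x+\mathbf y)\ge 0$, and into $B_-$ if $\mathbf h\cdot(\mathbf x+\mathbf y)\le 0$. 3. (Reduction) Remove every $\mathbf b\in B_+$ for which some $\mathbf b'\in B_+$, $\mathbf b'\ne\mathbf b$, has $\mathbf b-\mathbf b'\ge 0$ and $\mathbf h\cdot(\mathbf b-\mathbf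 b')\ge 0$. Remove every $\mathbf b\in B_-$ for which some $\mathbf b'\in B_-$, $\mathbf b'\neq\mathbf b$, has $\mathbf b-\mathbf b'\ge 0$ and $\mathbf h\cdot(\mathbf b-\mathbf b')\le 0$. 4. If this round of expansion and reduction has left both $B_+$ and $B_-$ unchanged, set $B^{(i)}=B_+\cap B_-$ and stop; otherwise return to step 2. Then the algorithm terminates, that is, for every $i$ the loop stops after finitely many rounds. For every $0\le k\le 3f$, the set $B^{(k)}$ consists of exactly those elements of $\mathrm{Hilb}(\mathscr P^{(k)})$ that satisfy the quadrilateral constraints. The output $B^{(3f)}$ is exactly the set of vector representations of the fundamental normal surfaces in $\mathcal T$. -/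

import Mathlib

namespace NormalSurfaces

/-! ### Cones and Hilbert bases -/

section HilbertBases

variable {ι : Type*}

/-- The integer points of a subset of `ℝ^ι`. -/
def intPoints (P : Set (ι → ℝ)) : Set (ι → ℤ) :=
  {x | (fun c => (x c : ℝ)) ∈ P}

/-- The Hilbert basis of a pointed cone `P`: the non-zero integer points of `P` that are not the sum
of two non-zero integer points of `P`. -/
def hilb (P : Set (ι → ℝ)) : Set (ι → ℤ) :=
  {x | x ∈ intPoints P ∧ x ≠ 0 ∧
    ∀ y ∈ intPoints P, ∀ z ∈ intPoints P, x = y + z → y = 0 ∨ z = 0}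

/-- The cone `{x ∈ ℝ^ι | x ≥ 0 and the first k rows of A vanish on x}`. -/
def partialCone [Fintype ι] {m : ℕ} (A : Matrix (Fin m) ι ℤ) (k : ℕ) : Set (ι → ℝ) :=
  {x | (∀ i : Fin m, (i : ℕ) < k → ∑ c, (A i c : ℝ) * x c = 0) ∧ ∀ c, 0 ≤ x c}

/-- `hilb` of such a cone is the least set of integer points that generates all integer points of
the cone under addition. -/
theorem isLeast_hilb_partialCone [Fintype ι] {m : ℕ} (A : Matrix (Fin m) ι ℤ) (k : ℕ) :
    IsLeast {H : Set (ι → ℤ) | (AddSubmonoid.closure H : Set (ι → ℤ)) = intPoints (partialCone A k)}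
      (hilb (partialCone A k)) := by
  have hnn : ∀ x ∈ intPoints (partialCone A k), ∀ c, 0 ≤ x c := by
    intro x hx c
    have h : (0 : ℝ) ≤ (x c : ℝ) := hx.2 c
    exact_mod_cast h
  have hzero : (0 : ι → ℤ) ∈ intPoints (partialCone A k) := by
    refine ⟨fun i _ => ?_, fun c => ?_⟩ <;> simp
  have hadd : ∀ x ∈ intPoints (partialCone A k), ∀ y ∈ intPoints (partialCone A k),
      x + y ∈ intPoints (partialCone A k) := by
    intro x hx y hy
    refine ⟨fun i hi => ?_, fun c => ?_⟩
    · have h1 := hx.1 i hi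
      have h2 := hy.1 i hi
      simp only [Pi.add_apply, Int.cast_add, mul_add, Finset.sum_add_distrib]
      simp only at h1 h2
      rw [h1, h2, add_zero]
    · have h1 := hx.2 c
      have h2 := hy.2 c
      simp only [Pi.add_apply, Int.cast_add]
      exact add_nonneg h1 h2
  refine ⟨?_, ?_⟩
  · apply Set.Subset.antisymm
    · intro x hx
      refine AddSubmonoid.closure_induction (motive := fun x _ => x ∈ intPoints (partialCone A k))
        (fun y hy => hy.1) hzero (fun y z _ _ hy hz => hadd y hy z hz) hx
    · intro x hx
      have key : ∀ N : ℕ, ∀ x ∈ intPoints (partialCone A k), ∑ c, x c < N →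
          x ∈ AddSubmonoid.closure (hilb (partialCone A k)) := by
        intro N
        induction N with
        | zero =>
          intro x hx hN
          have := Finset.sum_nonneg (fun c (_ : c ∈ Finset.univ) => hnn x hx c)
          simp at hN
          omega
        | succ N ih =>
          intro x hx hN
          by_cases h0 : x = 0
          · rw [h0]; exact zero_mem _
          by_cases hh : x ∈ hilb (partialCone A k)
          · exact AddSubmonoid.subset_closure hh
          have : ∃ y ∈ intPoints (partialCone A k), ∃ z ∈ intPoints (partialCone A k),
              x = y + z ∧ y ≠ 0 ∧ z ≠ 0 := by
            by_contra hcon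
            push Not at hcon
            refine hh ⟨hx, h0, fun y hy z hz hxy => ?_⟩
            by_contra hc
            push Not at hc
            exact hc.2 (hcon y hy z hz hxy hc.1)
          obtain ⟨y, hy, z, hz, rfl, hy0, hz0⟩ := this
          have hpos : ∀ w ∈ intPoints (partialCone A k), w ≠ 0 → 0 < ∑ c, w c := by
            intro w hw hw0
            obtain ⟨c, hc⟩ := Function.ne_iff.mp hw0
            refine Finset.sum_pos' (fun c _ => hnn w hw c) ⟨c, Finset.mem_univ c, ?_⟩
            exact lt_of_le_of_ne (hnn w hw c) (Ne.symm hc)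
          have h1 := hpos y hy hy0
          have h2 := hpos z hz hz0
          simp only [Pi.add_apply, Finset.sum_add_distrib] at hN
          push_cast at hN
          exact add_mem (ih y hy (by linarith)) (ih z hz (by linarith))
      exact key ((∑ c, x c).toNat + 1) x hx (by omega)
  · intro H hH x hx
    have hsub : ∀ y ∈ AddSubmonoid.closure H, y ∈ intPoints (partialCone A k) := by
      intro y hy
      have hH' : (AddSubmonoid.closure H : Set (ι → ℤ)) = intPoints (partialCone A k) := hH
      rw [← hH']
      exact hy
    have hxH : x ∈ AddSubmonoid.closure H := by
      have hH' : (AddSubmonoid.closure H : Set (ι → ℤ)) = intPoints (partialCone A k) := hH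
      have := hx.1
      rw [← hH'] at this
      exact this
    have key : ∀ y ∈ AddSubmonoid.closure H, y ∈ hilb (partialCone A k) → y ∈ H := by
      intro y hy
      refine AddSubmonoid.closure_induction
        (motive := fun y _ => y ∈ hilb (partialCone A k) → y ∈ H)
        (fun y hy _ => hy) (fun h => absurd rfl h.2.1) (fun y z hyc hzc ihy ihz h => ?_) hy
      rcases h.2.2 y (hsub y hyc) z (hsub z hzc) rfl with h0 | h0
      · subst h0
        rw [zero_add] at h ⊢
        exact ihz h
      · subst h0
        rw [add_zero] at h ⊢
        exact ihy h
    exact key x hxH hx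

end HilbertBases

/-! ### Triangulations and matching equations -/

/-- Disc types in a tetrahedron with vertices `0, 1, 2, 3`: `Sum.inl v` is the triangle that
separates `v` from the other vertices, and `Sum.inr q` is the quadrilateral that separates
`{0, q + 1}` from the other two vertices. -/
abbrev DiscType : Type := Fin 4 ⊕ Fin 3

/-- The coordinates of the vector representation, `7` for each of the `n` tetrahedra. -/
abbrev Coord (n : ℕ) : Type := Fin n × DiscType

/-- The side of a disc of the given type on which a vertex of the tetrahedron lies. -/
def DiscType.side : DiscType → Fin 4 → Bool
  | Sum.inl v, a => decide (a = v)
  | Sum.inr q, a => decide (a = 0 ∨ a = q.succ)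

/-- Discs of type `d` separate the vertices `a` and `b`, i.e. they meet the edge `ab`. -/
def DiscType.Separates (d : DiscType) (a b : Fin 4) : Prop :=
  DiscType.side d a ≠ DiscType.side d b

instance (d : DiscType) (a b : Fin 4) : Decidable (DiscType.Separates d a b) :=
  inferInstanceAs (Decidable (_ ≠ _))

/-- In the face opposite the vertex `f`, discs of type `d` have an arc that cuts off the
vertex `v ≠ f` from the two other vertices of this face. -/
def DiscType.CutsOff (d : DiscType) (f v : Fin 4) : Prop :=
  ∀ u, u ≠ v → u ≠ f → DiscType.Separates d v u

instance (d : DiscType) (f v : Fin 4) : Decidable (DiscType.CutsOff d f v) :=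
  inferInstanceAs (Decidable (∀ _, _))

/-- A triangulation formed from `n` tetrahedra, each with vertices `0, 1, 2, 3`, by gluing some or
all of their faces in pairs. Face `f` of a tetrahedron is the face opposite its vertex `f`.
`glue t f = none` says that face `f` of tetrahedron `t` is a boundary face, and
`glue t f = some (t', σ)` that it is glued to face `σ f` of tetrahedron `t'` by the affine map that
sends each vertex `v ≠ f` of `t` to the vertex `σ v` of `t'`. -/
structure Triangulation (n : ℕ) where
  glue : Fin n → Fin 4 → Option (Fin n × Equiv.Perm (Fin 4))
  glue_symm : ∀ t f t' σ, glue t f = some (t', σ) → glue t' (σ f) = some (t, σ⁻¹)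
  glue_ne : ∀ t f t' σ, glue t f = some (t', σ) → (t', σ f) ≠ (t, f)

/-- The non-boundary faces of the triangulation. Each of them is a pair of glued tetrahedron faces
and is represented by the lexicographically smaller one. -/
def Triangulation.InternalFace {n : ℕ} (T : Triangulation n) : Type :=
  {p : Fin n × Fin 4 // ∃ t' σ, T.glue p.1 p.2 = some (t', σ) ∧ toLex p < toLex (t', σ p.2)}

/-- The number of non-boundary faces. -/
noncomputable def Triangulation.numInternalFaces {n : ℕ} (T : Triangulation n) : ℕ :=
  Nat.card T.InternalFace

/-- The matching equation at face `f` of tetrahedron `t` and vertex `v` of this face: the arcs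
around `v` that come from `t` are as many as those that come from the adjacent tetrahedron. -/
def Triangulation.matchingEquation {n : ℕ} (T : Triangulation n) (t : Fin n) (f v : Fin 4) :
    Coord n → ℤ :=
  fun c => match T.glue t f with
    | none => 0
    | some (t', σ) =>
      (if c.1 = t ∧ DiscType.CutsOff c.2 f v then 1 else 0) -
        (if c.1 = t' ∧ DiscType.CutsOff c.2 (σ f) (σ v) then 1 else 0)

/-- The matching matrix; the three rows of a non-boundary face are indexed by its vertices, that
is, by the vertices `f.succAbove j ≠ f` for `j = 0, 1, 2`. -/
def Triangulation.matchingMatrix {n : ℕ} (T : Triangulation n) :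
    Matrix (T.InternalFace × Fin 3) (Coord n) ℤ :=
  fun r => T.matchingEquation r.1.1.1 r.1.1.2 (r.1.1.2.succAbove r.2)

/-- The quadrilateral constraints: in each tetrahedron at most one of the three quadrilateral
coordinates is non-zero. -/
def QuadConstraints {n : ℕ} (x : Coord n → ℤ) : Prop :=
  ∀ (t : Fin n) (q q' : Fin 3), x (t, Sum.inr q) ≠ 0 → x (t, Sum.inr q') ≠ 0 → q = q'

instance {n : ℕ} (x : Coord n → ℤ) : Decidable (QuadConstraints x) :=
  inferInstanceAs (Decidable (∀ _, _))

/-! ### Normal surfaces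

Points of a tetrahedron are given by barycentric coordinates in `ℝ^4`. A normal surface is
considered up to isotopies that preserve the simplices of the triangulation. Hence all its normal
arcs may be taken to be straight, and a normal disc may be given by its boundary curve, a closed
polygon in the boundary of the tetrahedron. Such curves bound pairwise disjoint discs exactly if
the curves are pairwise disjoint. -/

/-- A vertex of the tetrahedron. -/
def vertexPoint (a : Fin 4) : Fin 4 → ℝ := Pi.single a 1

/-- `C` is the boundary curve of a normal disc of type `d`: it has one corner in the interior of
each edge that discs of type `d` meet, and in each face `abc` in which such discs cut off a
vertex `a` it consists of the segment between the corners on `ab` and `ac`. -/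
def IsNormalDisc (d : DiscType) (C : Set (Fin 4 → ℝ)) : Prop :=
  ∃ corner : Fin 4 → Fin 4 → (Fin 4 → ℝ),
    (∀ a b, DiscType.Separates d a b →
      corner a b = corner b a ∧
        corner a b ∈ openSegment ℝ (vertexPoint a) (vertexPoint b)) ∧
    C = {p | ∃ a b c, b ≠ c ∧ DiscType.Separates d a b ∧ DiscType.Separates d a c ∧
      p ∈ segment ℝ (corner a b) (corner a c)}

/-- A normal surface: in each tetrahedron a finite collection of pairwise disjoint normal discs,
sorted by their types, such that on any two faces that are glued together the traces of the
discs agree. The surface may be disconnected or empty. -/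
structure NormalSurface {n : ℕ} (T : Triangulation n) where
  discs : Fin n → DiscType → Finset (Set (Fin 4 → ℝ))
  isNormalDisc : ∀ t d, ∀ C ∈ discs t d, IsNormalDisc d C
  disjoint : ∀ t d d', ∀ C ∈ discs t d, ∀ C' ∈ discs t d', (d ≠ d' ∨ C ≠ C') → Disjoint C C'
  glue : ∀ t f t' σ, T.glue t f = some (t', σ) →
    ∀ p : Fin 4 → ℝ, p f = 0 →
      ((∃ d, ∃ C ∈ discs t d, p ∈ C) ↔
        ∃ d, ∃ C ∈ discs t' d, (fun v => p (σ⁻¹ v)) ∈ C)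

/-- The vector representation: the number of discs of each type in each tetrahedron. -/
def NormalSurface.vec {n : ℕ} {T : Triangulation n} (S : NormalSurface T) : Coord n → ℤ :=
  fun c => ((S.discs c.1 c.2).card : ℤ)

/-- Fundamental normal surfaces: non-empty normal surfaces `S` such that `vec S = vec U + vec V`
for normal surfaces `U`, `V` only if `vec U = 0` or `vec V = 0`. -/
def NormalSurface.IsFundamental {n : ℕ} {T : Triangulation n} (S : NormalSurface T) : Prop :=
  S.vec ≠ 0 ∧ ∀ U V : NormalSurface T, S.vec = U.vec + V.vec → U.vec = 0 ∨ V.vec = 0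

/-! ### The dual algorithm -/

/-- The working sets `(B₊, B₋)` of the inductive step. -/
abbrev WorkingSets (n : ℕ) : Type := Finset (Coord n → ℤ) × Finset (Coord n → ℤ)

/-- Initial working sets of the inductive step for the vector `h` and the input basis `B`. -/
def initialSets {n : ℕ} (h : Coord n → ℤ) (B : Finset (Coord n → ℤ)) : WorkingSets n :=
  (B.filter fun x => 0 ≤ h ⬝ᵥ x, B.filter fun x => h ⬝ᵥ x ≤ 0)

/-- The sums `x + y` with `x ∈ B₊`, `y ∈ B₋` and `h · x > 0 > h · y` that satisfy the quadrilateral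
constraints. -/
def admissibleSums {n : ℕ} (h : Coord n → ℤ) (s : WorkingSets n) : Finset (Coord n → ℤ) :=
  ((s.1 ×ˢ s.2).filter fun p => 0 < h ⬝ᵥ p.1 ∧ h ⬝ᵥ p.2 < 0 ∧ QuadConstraints (p.1 + p.2)).image
    fun p => p.1 + p.2

/-- The modified expansion step. -/
def expand {n : ℕ} (h : Coord n → ℤ) (s : WorkingSets n) : WorkingSets n :=
  (s.1 ∪ (admissibleSums h s).filter (fun x => 0 ≤ h ⬝ᵥ x),
    s.2 ∪ (admissibleSums h s).filter (fun x => h ⬝ᵥ x ≤ 0))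

/-- The modified, cone-free reduction step: remove `b` if there is a different `b'` in the same set
with `b - b' ≥ 0` and `h · (b - b') ≥ 0` (for `B₊`) or `h · (b - b') ≤ 0` (for `B₋`). -/
def reduce {n : ℕ} (h : Coord n → ℤ) (s : WorkingSets n) : WorkingSets n :=
  (s.1.filter fun b => ¬ ∃ b' ∈ s.1, b' ≠ b ∧ (∀ c, 0 ≤ (b - b') c) ∧ 0 ≤ h ⬝ᵥ (b - b'),
    s.2.filter fun b => ¬ ∃ b' ∈ s.2, b' ≠ b ∧ (∀ c, 0 ≤ (b - b') c) ∧ h ⬝ᵥ (b - b') ≤ 0)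

/-- One round of expansion and reduction. -/
def fullRound {n : ℕ} (h : Coord n → ℤ) (s : WorkingSets n) : WorkingSets n :=
  reduce h (expand h s)

/-- The loop of the modified inductive step: perform rounds of expansion and reduction, and stop
as soon as a round leaves both working sets unchanged. The value is undefined exactly if the loop
runs forever. -/
def roundLoop {n : ℕ} (h : Coord n → ℤ) : WorkingSets n →. WorkingSets n :=
  PFun.fix fun s =>
    Part.some (if fullRound h s = s then Sum.inl (fullRound h s) else Sum.inr (fullRound h s))

/-- The dual algorithm for the ordered rows of `A`: the candidate basis `B^(k)`, for `0 ≤ k ≤ m`.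
`B^(0)` is the set of unit vectors, and `B^(i+1) = B₊ ∩ B₋` for the output `(B₊, B₋)` of the modified
inductive step with input basis `B^(i)` and the next row of `A`. The value is undefined exactly if
one of the loops runs forever. -/
def candidateBasis {n m : ℕ} (A : Matrix (Fin m) (Coord n) ℤ) (k : Fin (m + 1)) :
    Part (Finset (Coord n → ℤ)) :=
  Fin.induction (motive := fun _ => Part (Finset (Coord n → ℤ)))
    (Part.some (Finset.univ.image fun c => Pi.single c 1))
    (fun i B => B.bind fun b =>
      (roundLoop (A i) (initialSets (A i) b)).map fun s => s.1 ∩ s.2) k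

end NormalSurfaces

open NormalSurfaces

/-! There are two independent halves: correctness of the algorithm on any integer matrix, and
Haken's description of normal surfaces by admissible vectors.

For the algorithm, fix the cone `P` of the previous step, the next row `h`, and the half-cones `± h
· x ≥ 0` of `P`. Cone-free reduction keeps the minimal elements for the orders `Below h` and `Below
(-h)`. A pair of working sets that is stable under a round contains every admissible irreducible
element of either half-cone (`mem_of_irred_half_of_stable`): such a `z` is irreducible in `P` or
splits as `u + v` across the hyperplane, and a splitting with least `h · u` must be a sum that
expansion inserts. The quadrilateral filter is harmless because a summand of an admissible vector is
admissible. Conversely, reduction removes everything reducible. The hyperplane is a face of both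
half-cones, so intersecting the two sets gives the irreducible elements of the new cone. The loop
stops because the orders are well-quasi-orders (Dickson's lemma), while each round without stability
adds an element above nothing older (`exists_iterate_stable`).

For surfaces, intersections with edges count corners. These counts agree across glued faces and
determine the arc counts, which gives the matching equations; two quadrilateral types in one
tetrahedron always intersect (`not_disjoint_quads`). For the converse, place the corners on each
edge equally spaced. The trace on a face then depends only on its three arc counts, so the matching
equations make the traces agree (`exists_normalSurface`). Hence fundamental surfaces correspond to
admissible irreducible vectors. -/

namespace NormalSurfaces

/-! ### Irreducible elements of cones of integer points -/

section Irreducibles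

variable {ι : Type*}

/-- A set of non-negative integer vectors that is closed under sums and non-negative differences. -/
structure IsIntCone (P : Set (ι → ℤ)) : Prop where
  nonneg : ∀ x ∈ P, 0 ≤ x
  add_mem : ∀ x ∈ P, ∀ y ∈ P, x + y ∈ P
  sub_mem : ∀ x ∈ P, ∀ y ∈ P, y ≤ x → x - y ∈ P

/-- The non-zero elements that are not the sum of two non-zero elements. -/
def irred (P : Set (ι → ℤ)) : Set (ι → ℤ) :=
  {x | x ∈ P ∧ x ≠ 0 ∧ ∀ y ∈ P, ∀ z ∈ P, x = y + z → y = 0 ∨ z = 0}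

variable [Fintype ι]

/-- The elements on which `h` is non-negative. -/
def half (h : ι → ℤ) (P : Set (ι → ℤ)) : Set (ι → ℤ) := {x | x ∈ P ∧ 0 ≤ h ⬝ᵥ x}

/-- The order whose non-negative elements are the `x ≥ 0` with `h · x ≥ 0`. -/
def Below (h x y : ι → ℤ) : Prop := x ≤ y ∧ h ⬝ᵥ x ≤ h ⬝ᵥ y

theorem Below.trans {h x y z : ι → ℤ} (hxy : Below h x y) (hyz : Below h y z) : Below h x z :=
  ⟨hxy.1.trans hyz.1, hxy.2.trans hyz.2⟩

theorem Below.refl (h x : ι → ℤ) : Below h x x := ⟨le_rfl, le_rfl⟩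

theorem Below.antisymm {h x y : ι → ℤ} (hxy : Below h x y) (hyx : Below h y x) : x = y :=
  le_antisymm hxy.1 hyx.1

theorem sum_pos_of_nonneg_of_ne_zero {x : ι → ℤ} (hx : 0 ≤ x) (h0 : x ≠ 0) : 0 < ∑ c, x c := by
  obtain ⟨c, hc⟩ := Function.ne_iff.mp h0
  exact Finset.sum_pos' (fun c _ => hx c) ⟨c, Finset.mem_univ c, lt_of_le_of_ne (hx c) (Ne.symm hc)⟩

/-- An element of a half-cone with a property that passes to a summand dominates an irreducible one
with the same property. -/
theorem exists_irred_below {P : Set (ι → ℤ)} (hP : IsIntCone P) (h : ι → ℤ)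
    {p : (ι → ℤ) → Prop} (hp0 : ¬ p 0)
    (hp : ∀ y ∈ half h P, ∀ z ∈ half h P, p (y + z) → p y ∨ p z) {u : ι → ℤ} (hu : u ∈ half h P)
    (hpu : p u) : ∃ w ∈ irred (half h P), Below h w u ∧ p w := by
  -- Induction on the coordinate sum, which drops when a reducible vector is replaced by one of its
  -- two summands.
  have key : ∀ N : ℕ, ∀ u ∈ half h P, ∑ c, u c < N → p u →
      ∃ w ∈ irred (half h P), Below h w u ∧ p w := by
    intro N
    induction N with
    | zero =>
      intro u hu hN
      have := Finset.sum_nonneg (fun c (_ : c ∈ Finset.univ) => hP.nonneg u hu.1 c)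
      simp at hN this
      omega
    | succ N ih =>
      intro u hu hN hpu
      have hu0 : u ≠ 0 := by rintro rfl; exact hp0 hpu
      by_cases hh : u ∈ irred (half h P)
      · exact ⟨u, hh, .refl h u, hpu⟩
      have : ∃ y ∈ half h P, ∃ z ∈ half h P, u = y + z ∧ y ≠ 0 ∧ z ≠ 0 := by
        by_contra hcon
        push Not at hcon
        refine hh ⟨hu, hu0, fun y hy z hz hxy => ?_⟩
        by_contra hc
        push Not at hc
        exact hc.2 (hcon y hy z hz hxy hc.1)
      obtain ⟨y, hy, z, hz, rfl, hy0, hz0⟩ := this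
      have h1 := sum_pos_of_nonneg_of_ne_zero (hP.nonneg y hy.1) hy0
      have h2 := sum_pos_of_nonneg_of_ne_zero (hP.nonneg z hz.1) hz0
      simp only [Pi.add_apply, Finset.sum_add_distrib] at hN
      push_cast at hN
      have hy2 := hy.2
      have hz2 := hz.2
      rcases hp y hy z hz hpu with hc | hc
      · obtain ⟨w, hw, hb, hwp⟩ := ih y hy (by omega) hc
        refine ⟨w, hw, hb.trans ⟨le_add_of_nonneg_right (hP.nonneg z hz.1), ?_⟩, hwp⟩
        rw [dotProduct_add]; omega
      · obtain ⟨w, hw, hb, hwp⟩ := ih z hz (by omega) hc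
        refine ⟨w, hw, hb.trans ⟨le_add_of_nonneg_left (hP.nonneg y hy.1), ?_⟩, hwp⟩
        rw [dotProduct_add]; omega
  exact key ((∑ c, u c).toNat + 1) u hu (by omega) hpu

/-- A vector on which `h` is positive dominates an irreducible one with the same property. -/
theorem exists_irred_below_pos {P : Set (ι → ℤ)} (hP : IsIntCone P) (h : ι → ℤ) {u : ι → ℤ}
    (hu : u ∈ P) (hpos : 0 < h ⬝ᵥ u) :
    ∃ w ∈ irred (half h P), Below h w u ∧ 0 < h ⬝ᵥ w := by
  refine exists_irred_below hP h (p := fun w => 0 < h ⬝ᵥ w) (by simp) (fun y hy z hz hyz => ?_)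
    ⟨hu, hpos.le⟩ hpos
  rw [dotProduct_add] at hyz
  have := hy.2
  have := hz.2
  omega

/-- The difference `y - x` lies in the half-cone too, so `y = x + (y - x)` would split `y`. Thus
irreducible elements are minimal among the non-zero ones and are never removed by reduction. -/
theorem eq_of_below_irred {P : Set (ι → ℤ)} (hP : IsIntCone P) {h x y : ι → ℤ}
    (hy : y ∈ irred (half h P)) (hx : x ∈ half h P) (hx0 : x ≠ 0) (hxy : Below h x y) : x = y := by
  have := hy.2.2 x hx (y - x) ⟨hP.sub_mem y hy.1.1 x hx.1 hxy.1, ?_⟩ (by abel)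
  · exact (sub_eq_zero.mp (this.resolve_left hx0)).symm
  · rw [dotProduct_sub]; have := hxy.2; omega

/-- If an element is irreducible in a half-cone but not in the full cone, it is the sum of two
non-zero elements that lie strictly on the two sides of the hyperplane. -/
theorem exists_split {P : Set (ι → ℤ)} {h z : ι → ℤ} (hz : z ∈ irred (half h P))
    (hzP : z ∉ irred P) :
    ∃ u ∈ P, ∃ v ∈ P, z = u + v ∧ 0 < h ⬝ᵥ u ∧ h ⬝ᵥ v < 0 := by
  have : ∃ u ∈ P, ∃ v ∈ P, z = u + v ∧ u ≠ 0 ∧ v ≠ 0 := by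
    by_contra hcon
    push Not at hcon
    refine hzP ⟨hz.1.1, hz.2.1, fun y hy z hz hxy => ?_⟩
    by_contra hc
    push Not at hc
    exact hc.2 (hcon y hy z hz hxy hc.1)
  obtain ⟨u, hu, v, hv, rfl, hu0, hv0⟩ := this
  have h0 := hz.1.2
  rw [dotProduct_add] at h0
  by_cases h1 : h ⬝ᵥ v < 0
  · exact ⟨u, hu, v, hv, rfl, by omega, h1⟩
  by_cases h2 : h ⬝ᵥ u < 0
  · exact ⟨v, hv, u, hu, add_comm _ _, by omega, h2⟩
  · have := hz.2.2 u ⟨hu, by omega⟩ v ⟨hv, by omega⟩ rfl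
    tauto

/-- `irred` of the intersection of a cone with a hyperplane. -/
theorem mem_irred_hyperplane_iff {P : Set (ι → ℤ)} {h x : ι → ℤ} :
    x ∈ irred {y | y ∈ P ∧ h ⬝ᵥ y = 0} ↔ x ∈ irred (half h P) ∧ x ∈ irred (half (-h) P) := by
  constructor
  · rintro ⟨⟨hx, h0⟩, hx0, hirr⟩
    refine ⟨⟨⟨hx, h0.ge⟩, hx0, fun y hy z hz hyz => ?_⟩,
      ⟨⟨hx, by simp [h0]⟩, hx0, fun y hy z hz hyz => ?_⟩⟩
    -- The hyperplane is a face of the half-cone: non-negative values of `h` with sum zero both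
    -- vanish.
    · have hy2 := hy.2
      have hz2 := hz.2
      rw [hyz, dotProduct_add] at h0
      exact hirr y ⟨hy.1, by omega⟩ z ⟨hz.1, by omega⟩ hyz
    · have hy2 := hy.2
      have hz2 := hz.2
      rw [neg_dotProduct] at hy2 hz2
      rw [hyz, dotProduct_add] at h0
      exact hirr y ⟨hy.1, by omega⟩ z ⟨hz.1, by omega⟩ hyz
  · rintro ⟨⟨h1, hx0, hirr⟩, h2, -⟩
    have h1' := h1.2
    have h2' := h2.2
    rw [neg_dotProduct] at h2'
    exact ⟨⟨h1.1, by omega⟩, hx0, fun y hy z hz hyz =>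
      hirr y ⟨hy.1, hy.2.ge⟩ z ⟨hz.1, hz.2.ge⟩ hyz⟩

end Irreducibles

/-! ### Rounds of expansion and reduction -/

section Rounds

variable {n : ℕ}

/-- The constraint concerns only the support. Hence summands of admissible vectors are admissible,
and the filter in the expansion discards nothing from which an admissible vector could be built. -/
theorem QuadConstraints.of_le {x y : Coord n → ℤ} (hy : QuadConstraints y) (hx0 : 0 ≤ x)
    (hxy : x ≤ y) : QuadConstraints x := by
  have pos : ∀ c, x c ≠ 0 → y c ≠ 0 := fun c hc => by
    have h1 : 0 ≤ x c := hx0 c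
    have h2 : x c ≤ y c := hxy c
    omega
  exact fun t q q' hq hq' => hy t q q' (pos _ hq) (pos _ hq')

theorem mem_reduce_fst {h : Coord n → ℤ} {s : WorkingSets n} {b : Coord n → ℤ} :
    b ∈ (reduce h s).1 ↔ b ∈ s.1 ∧ ∀ b' ∈ s.1, Below h b' b → b' = b := by
  simp only [reduce, Finset.mem_filter, not_exists, not_and, Below, Pi.sub_apply, sub_nonneg,
    dotProduct_sub, Pi.le_def]
  refine and_congr_right fun _ => forall₂_congr fun b' _ => ?_
  tauto

theorem mem_admissibleSums {h : Coord n → ℤ} {s : WorkingSets n} {z : Coord n → ℤ} :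
    z ∈ admissibleSums h s ↔ ∃ x ∈ s.1, ∃ y ∈ s.2, 0 < h ⬝ᵥ x ∧ h ⬝ᵥ y < 0 ∧
      QuadConstraints (x + y) ∧ x + y = z := by
  simp only [admissibleSums, Finset.mem_image, Finset.mem_filter, Finset.mem_product, Prod.exists]
  constructor
  · rintro ⟨x, y, ⟨⟨hx, hy⟩, h1, h2, h3⟩, rfl⟩
    exact ⟨x, hx, y, hy, h1, h2, h3, rfl⟩
  · rintro ⟨x, hx, y, hy, h1, h2, h3, rfl⟩
    exact ⟨x, y, ⟨⟨hx, hy⟩, h1, h2, h3⟩, rfl⟩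

theorem mem_expand_fst {h : Coord n → ℤ} {s : WorkingSets n} {z : Coord n → ℤ} :
    z ∈ (expand h s).1 ↔ z ∈ s.1 ∨ (0 ≤ h ⬝ᵥ z ∧ ∃ x ∈ s.1, ∃ y ∈ s.2, 0 < h ⬝ᵥ x ∧ h ⬝ᵥ y < 0 ∧
      QuadConstraints (x + y) ∧ x + y = z) := by
  simp only [expand, Finset.mem_union, Finset.mem_filter, mem_admissibleSums, and_comm]

/-- Replacing `h` by `-h` exchanges the two working sets. With this symmetry everything needs to be
proved only for the first set. -/
theorem admissibleSums_swap (h : Coord n → ℤ) (s : WorkingSets n) :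
    admissibleSums (-h) s.swap = admissibleSums h s := by
  ext z
  simp only [mem_admissibleSums, neg_dotProduct, Prod.fst_swap, Prod.snd_swap]
  constructor
  · rintro ⟨x, hx, y, hy, h1, h2, h3, rfl⟩
    exact ⟨y, hy, x, hx, by omega, by omega, by rwa [add_comm], add_comm _ _⟩
  · rintro ⟨x, hx, y, hy, h1, h2, h3, rfl⟩
    exact ⟨y, hy, x, hx, by omega, by omega, by rwa [add_comm], add_comm _ _⟩

theorem expand_swap (h : Coord n → ℤ) (s : WorkingSets n) :
    expand (-h) s.swap = (expand h s).swap := by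
  simp [expand, admissibleSums_swap]

theorem reduce_swap (h : Coord n → ℤ) (s : WorkingSets n) :
    reduce (-h) s.swap = (reduce h s).swap := by
  simp [reduce]

theorem fullRound_swap (h : Coord n → ℤ) (s : WorkingSets n) :
    fullRound (-h) s.swap = (fullRound h s).swap := by
  rw [fullRound, expand_swap, reduce_swap, fullRound]

/-- Among the finitely many elements below `b`, one with least coordinate sum is minimal: anything
below it has the same sum, hence the same coordinates. -/
theorem exists_mem_reduce_fst_below (h : Coord n → ℤ) {s : WorkingSets n} {b : Coord n → ℤ}
    (hb : b ∈ s.1) : ∃ b' ∈ (reduce h s).1, Below h b' b := by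
  classical
  obtain ⟨m, hm, hmin⟩ := Finset.exists_min_image (s.1.filter fun x => Below h x b)
    (fun x => ∑ c, x c) ⟨b, Finset.mem_filter.mpr ⟨hb, .refl h b⟩⟩
  rw [Finset.mem_filter] at hm
  refine ⟨m, mem_reduce_fst.mpr ⟨hm.1, fun b' hb' hbm => ?_⟩, hm.2⟩
  have h1 := hmin b' (Finset.mem_filter.mpr ⟨hb', hbm.trans hm.2⟩)
  have h2 : ∑ c, b' c = ∑ c, m c := le_antisymm (Finset.sum_le_sum fun c _ => hbm.1 c) h1
  funext c
  exact (Finset.sum_eq_sum_iff_of_le fun c _ => hbm.1 c).mp h2 c (Finset.mem_univ c)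

theorem exists_mem_fullRound_fst_below (h : Coord n → ℤ) {s : WorkingSets n} {b : Coord n → ℤ}
    (hb : b ∈ s.1) : ∃ b' ∈ (fullRound h s).1, Below h b' b :=
  exists_mem_reduce_fst_below h (mem_expand_fst.mpr (Or.inl hb))

/-- The invariant of one working set: it consists of non-zero admissible elements of the half-cone,
and contains the irreducible elements of the cone that lie in the half-cone. -/
structure HalfInvariant (P : Set (Coord n → ℤ)) (h : Coord n → ℤ) (B : Finset (Coord n → ℤ)) :
    Prop where
  mem_half : ∀ x ∈ B, x ∈ half h P
  ne_zero : ∀ x ∈ B, x ≠ 0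
  quad : ∀ x ∈ B, QuadConstraints x
  irred_mem : ∀ x ∈ irred P, QuadConstraints x → 0 ≤ h ⬝ᵥ x → x ∈ B

/-- The invariant of both working sets. -/
def Invariant (P : Set (Coord n → ℤ)) (h : Coord n → ℤ) (s : WorkingSets n) : Prop :=
  HalfInvariant P h s.1 ∧ HalfInvariant P (-h) s.2

theorem Invariant.swap {P : Set (Coord n → ℤ)} {h : Coord n → ℤ} {s : WorkingSets n}
    (hs : Invariant P h s) : Invariant P (-h) s.swap := ⟨hs.2, by rw [neg_neg]; exact hs.1⟩

theorem irred_half_of_irred {ι : Type*} [Fintype ι] {P : Set (ι → ℤ)} {h x : ι → ℤ}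
    (hx : x ∈ irred P) (h0 : 0 ≤ h ⬝ᵥ x) : x ∈ irred (half h P) :=
  ⟨⟨hx.1, h0⟩, hx.2.1, fun y hy z hz => hx.2.2 y hy.1 z hz.1⟩

/-- Expansion stays inside the cone and produces no zero vector, and an irreducible element survives
reduction by minimality (`eq_of_below_irred`). -/
theorem Invariant.fullRound_fst {P : Set (Coord n → ℤ)} (hP : IsIntCone P) {h : Coord n → ℤ}
    {s : WorkingSets n} (hs : Invariant P h s) : HalfInvariant P h (fullRound h s).1 := by
  have key : ∀ x ∈ (expand h s).1, x ∈ half h P ∧ x ≠ 0 ∧ QuadConstraints x := by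
    intro x hx
    rcases mem_expand_fst.mp hx with hx | ⟨h0, y, hy, z, hz, h1, h2, hq, rfl⟩
    · exact ⟨hs.1.mem_half x hx, hs.1.ne_zero x hx, hs.1.quad x hx⟩
    · have hyP := (hs.1.mem_half y hy).1
      have hzP := (hs.2.mem_half z hz).1
      refine ⟨⟨hP.add_mem y hyP z hzP, h0⟩, fun h => hs.1.ne_zero y hy ?_, hq⟩
      exact le_antisymm (h ▸ le_add_of_nonneg_right (hP.nonneg z hzP)) (hP.nonneg y hyP)
  refine ⟨fun x hx => (key x (mem_reduce_fst.mp hx).1).1,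
    fun x hx => (key x (mem_reduce_fst.mp hx).1).2.1,
    fun x hx => (key x (mem_reduce_fst.mp hx).1).2.2, fun x hx hq h0 => ?_⟩
  refine mem_reduce_fst.mpr ⟨mem_expand_fst.mpr (Or.inl (hs.1.irred_mem x hx hq h0)), ?_⟩
  intro b hb hbx
  exact eq_of_below_irred hP (irred_half_of_irred hx h0) (key b hb).1 (key b hb).2.1 hbx

theorem Invariant.fullRound {P : Set (Coord n → ℤ)} (hP : IsIntCone P) {h : Coord n → ℤ}
    {s : WorkingSets n} (hs : Invariant P h s) : Invariant P h (fullRound h s) := by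
  refine ⟨hs.fullRound_fst hP, ?_⟩
  have := hs.swap.fullRound_fst hP
  rwa [fullRound_swap] at this

/-- Expansion inserts the sum and reduction leaves something below it; by stability that element was
already present. -/
theorem exists_below_add_of_stable {h : Coord n → ℤ} {s : WorkingSets n} (hs : fullRound h s = s)
    {x y : Coord n → ℤ} (hx : x ∈ s.1) (hy : y ∈ s.2) (hhx : 0 < h ⬝ᵥ x) (hhy : h ⬝ᵥ y < 0)
    (hq : QuadConstraints (x + y)) (h0 : 0 ≤ h ⬝ᵥ (x + y)) : ∃ b ∈ s.1, Below h b (x + y) := by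
  have := exists_mem_reduce_fst_below h
    (mem_expand_fst.mpr (Or.inr ⟨h0, x, hx, y, hy, hhx, hhy, hq, rfl⟩))
  rwa [← fullRound, hs] at this

/-- The completeness argument. Split `z = u + v` across the hyperplane, and choose irreducible `x`
below `u` and `y` below `v` strictly on their respective sides. They are smaller than `z` and
admissible, so they are in the working sets by induction. Either `z = x + y`, which stability
handles, or moving `x` or `y` to the other summand gives a splitting with smaller `h · u`, or `z`
turns out to be reducible. -/
theorem mem_of_irred_half_of_stable {P : Set (Coord n → ℤ)} (hP : IsIntCone P) {h : Coord n → ℤ}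
    {s : WorkingSets n} (hinv : Invariant P h s) (hs : NormalSurfaces.fullRound h s = s)
    {z : Coord n → ℤ} (hz : z ∈ irred (half h P)) (hq : QuadConstraints z)
    (ih : ∀ w ∈ irred (half h P), QuadConstraints w → ∑ c, w c < ∑ c, z c → w ∈ s.1)
    (ih' : ∀ w ∈ irred (half (-h) P), QuadConstraints w → ∑ c, w c < ∑ c, z c → w ∈ s.2) :
    z ∈ s.1 := by
  by_cases hzP : z ∈ irred P
  · exact hinv.1.irred_mem z hzP hq hz.1.2
  obtain ⟨u₀, hu₀, v₀, hv₀, hz₀, hhu₀, hhv₀⟩ := exists_split hz hzP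
  have key : ∀ N : ℕ, ∀ u ∈ P, ∀ v ∈ P, z = u + v → 0 < h ⬝ᵥ u → h ⬝ᵥ v < 0 → h ⬝ᵥ u < N →
      z ∈ s.1 := by
    intro N
    induction N with
    | zero => intro u _ v _ _ h1 _ h2; push_cast at h2; omega
    | succ N ihN =>
      intro u hu v hv huv hhu hhv hN
      have hu0 : u ≠ 0 := by rintro rfl; simp at hhu
      have hv0 : v ≠ 0 := by rintro rfl; simp at hhv
      have hsu := sum_pos_of_nonneg_of_ne_zero (hP.nonneg u hu) hu0
      have hsv := sum_pos_of_nonneg_of_ne_zero (hP.nonneg v hv) hv0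
      have hsz : ∑ c, z c = ∑ c, u c + ∑ c, v c := by
        rw [huv]; simp [Finset.sum_add_distrib]
      have huz : u ≤ z := huv ▸ le_add_of_nonneg_right (hP.nonneg v hv)
      have hvz : v ≤ z := huv ▸ le_add_of_nonneg_left (hP.nonneg u hu)
      obtain ⟨x, hx, hxu, hhx⟩ := exists_irred_below_pos hP h hu hhu
      obtain ⟨y, hy, hyv, hhy⟩ := exists_irred_below_pos hP (-h) hv (by simpa using hhv)
      have hx1 : x ∈ s.1 := ih x hx (hq.of_le (hP.nonneg x hx.1.1) (hxu.1.trans huz))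
        (lt_of_le_of_lt (Finset.sum_le_sum fun c _ => hxu.1 c) (by omega))
      have hy1 : y ∈ s.2 := ih' y hy (hq.of_le (hP.nonneg y hy.1.1) (hyv.1.trans hvz))
        (lt_of_le_of_lt (Finset.sum_le_sum fun c _ => hyv.1 c) (by omega))
      have hhyv := hyv.2
      rw [neg_dotProduct] at hhy
      rw [neg_dotProduct, neg_dotProduct] at hhyv
      have hhxu := hxu.2
      have hu'P := hP.sub_mem u hu x hx.1.1 hxu.1
      have hv'P := hP.sub_mem v hv y hy.1.1 hyv.1
      have hxyP := hP.add_mem x hx.1.1 y hy.1.1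
      have hz0 := hz.1.2
      rw [huv, dotProduct_add] at hz0
      by_cases hsum : 0 ≤ h ⬝ᵥ (x + y)
      -- With `x + y` on the non-negative side, `y` can be moved to `u`. The new pair is a split
      -- inside the half-cone, impossible for `z`, unless `v - y` is zero or still strictly
      -- negative.
      · obtain hv' | hv' := eq_or_ne (v - y) 0
        · have hvy := sub_eq_zero.mp hv'
          have := hz.2.2 (x + y) ⟨hxyP, hsum⟩ (u - x) ⟨hu'P, by rw [dotProduct_sub]; omega⟩
            (by rw [huv, hvy]; abel)
          rcases this with h0 | h0
          · exfalso
            refine hx.2.1 (le_antisymm ?_ (hP.nonneg x hx.1.1))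
            rw [← h0]; exact le_add_of_nonneg_right (hP.nonneg y hy.1.1)
          · have hux := sub_eq_zero.mp h0
            have hzxy : z = x + y := by rw [huv, hux, hvy]
            obtain ⟨b, hb, hbz⟩ := exists_below_add_of_stable hs hx1 hy1 hhx (by omega)
              (hzxy ▸ hq) hsum
            rw [← hzxy] at hbz
            rwa [← eq_of_below_irred hP hz (hinv.1.mem_half b hb) (hinv.1.ne_zero b hb) hbz]
        · by_cases hvn : h ⬝ᵥ (v - y) < 0
          · refine ihN (x + y + (u - x)) (hP.add_mem _ hxyP _ hu'P) (v - y) hv'P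
              (by rw [huv]; abel) ?_ hvn ?_
            · rw [dotProduct_sub] at hvn
              simp only [dotProduct_add, dotProduct_sub]; omega
            · push_cast at hN
              simp only [dotProduct_add, dotProduct_sub]; omega
          · exfalso
            have := hz.2.2 (x + y + (u - x)) ⟨hP.add_mem _ hxyP _ hu'P, ?_⟩ (v - y)
              ⟨hv'P, by omega⟩ (by rw [huv]; abel)
            · rcases this with h0 | h0
              · refine hx.2.1 (le_antisymm ?_ (hP.nonneg x hx.1.1))
                rw [← h0, add_assoc]
                exact le_add_of_nonneg_right
                  (add_nonneg (hP.nonneg y hy.1.1) (hP.nonneg _ hu'P))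
              · exact hv' h0
            · rw [dotProduct_add, dotProduct_sub]; omega
      · rw [dotProduct_add] at hsum
        -- Here `x` moves to `v`. Positivity of `h · (u - x)` holds because `h · x < -h · y ≤ -h · v
        -- ≤ h · u`.
        refine ihN (u - x) hu'P (v - y + (x + y)) (hP.add_mem _ hv'P _ hxyP)
          (by rw [huv]; abel) ?_ ?_ ?_
        · rw [dotProduct_sub]; omega
        · simp only [dotProduct_add, dotProduct_sub]; omega
        · push_cast at hN
          rw [dotProduct_sub]; omega
  exact key ((h ⬝ᵥ u₀).toNat + 1) u₀ hu₀ v₀ hv₀ hz₀ hhu₀ hhv₀ (by push_cast; omega)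

/-- The induction on the coordinate sum must treat both half-cones at once, since a splitting uses
one smaller element from each. -/
theorem irred_half_subset_of_stable {P : Set (Coord n → ℤ)} (hP : IsIntCone P) {h : Coord n → ℤ}
    {s : WorkingSets n} (hinv : Invariant P h s) (hs : NormalSurfaces.fullRound h s = s) :
    (∀ z ∈ irred (half h P), QuadConstraints z → z ∈ s.1) ∧
      ∀ z ∈ irred (half (-h) P), QuadConstraints z → z ∈ s.2 := by
  have hs' : NormalSurfaces.fullRound (-h) s.swap = s.swap := by rw [fullRound_swap, hs]
  have key : ∀ N : ℕ,
      (∀ z ∈ irred (half h P), QuadConstraints z → ∑ c, z c < N → z ∈ s.1) ∧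
        ∀ z ∈ irred (half (-h) P), QuadConstraints z → ∑ c, z c < N → z ∈ s.2 := by
    intro N
    induction N with
    | zero =>
      constructor <;> intro z hz _ hN <;>
      · have := sum_pos_of_nonneg_of_ne_zero (hP.nonneg z hz.1.1) hz.2.1
        push_cast at hN
        omega
    | succ N ih =>
      push_cast
      constructor
      · intro z hz hq hN
        exact mem_of_irred_half_of_stable hP hinv hs hz hq
          (fun w hw hwq hwz => ih.1 w hw hwq (by omega))
          (fun w hw hwq hwz => ih.2 w hw hwq (by omega))
      · intro z hz hq hN
        exact mem_of_irred_half_of_stable hP hinv.swap hs' hz hq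
          (fun w hw hwq hwz => ih.2 w hw hwq (by omega))
          (fun w hw hwq hwz => ih.1 w (by rwa [neg_neg] at hw) hwq (by omega))
  exact ⟨fun z hz hq => (key ((∑ c, z c).toNat + 1)).1 z hz hq (by push_cast; omega),
    fun z hz hq => (key ((∑ c, z c).toNat + 1)).2 z hz hq (by push_cast; omega)⟩

/-- If `z = u + v` were reducible in the half-cone, an irreducible `w` below `u` would be in the set
by completeness. Reduction then forces `w = z`, hence `u = z` and `v = 0`. -/
theorem mem_fst_iff_of_stable {P : Set (Coord n → ℤ)} (hP : IsIntCone P) {h : Coord n → ℤ}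
    {s : WorkingSets n} (hinv : Invariant P h s) (hs : NormalSurfaces.fullRound h s = s)
    {z : Coord n → ℤ} : z ∈ s.1 ↔ z ∈ irred (half h P) ∧ QuadConstraints z := by
  refine ⟨fun hz => ⟨⟨hinv.1.mem_half z hz, hinv.1.ne_zero z hz, fun u hu v hv huv => ?_⟩,
    hinv.1.quad z hz⟩, fun hz => (irred_half_subset_of_stable hP hinv hs).1 z hz.1 hz.2⟩
  by_contra hc
  push Not at hc
  have huz : Below h u z := by
    subst huv
    refine ⟨le_add_of_nonneg_right (hP.nonneg v hv.1), ?_⟩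
    rw [dotProduct_add]
    have := hv.2
    omega
  obtain ⟨w, hw, hwu, -⟩ := exists_irred_below hP h (p := fun w => w ≠ 0) (by simp)
    (fun y _ z _ hyz => by by_contra hc; push Not at hc; exact hyz (by rw [hc.1, hc.2, add_zero]))
    hu hc.1
  have hws : w ∈ s.1 := (irred_half_subset_of_stable hP hinv hs).1 w hw
    ((hinv.1.quad z hz).of_le (hP.nonneg w hw.1.1) (hwu.trans huz).1)
  have hwz : w = z := by
    rw [← hs] at hz
    refine (mem_reduce_fst.mp hz).2 w (mem_expand_fst.mpr (Or.inl hws)) (hwu.trans huz)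
  have huz' : u = z := Below.antisymm huz (hwz ▸ hwu)
  exact hc.2 (by simpa [huz'] using huv)

/-! ### Termination -/

/-- Reduced sets are antichains for `Below`, and antichains that dominate each other coincide. -/
theorem eq_of_below_below {h : Coord n → ℤ} {s s' : WorkingSets n}
    (h1 : ∀ b ∈ (reduce h s').1, ∃ b' ∈ (reduce h s).1, Below h b' b)
    (h2 : ∀ b ∈ (reduce h s).1, ∃ b' ∈ (reduce h s').1, Below h b' b) :
    (reduce h s).1 = (reduce h s').1 := by
  have key : ∀ s s' : WorkingSets n,
      (∀ b ∈ (reduce h s').1, ∃ b' ∈ (reduce h s).1, Below h b' b) →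
      (∀ b ∈ (reduce h s).1, ∃ b' ∈ (reduce h s').1, Below h b' b) →
      (reduce h s).1 ⊆ (reduce h s').1 := by
    intro s s' h1 h2 b hb
    obtain ⟨b', hb', hbb'⟩ := h2 b hb
    obtain ⟨b'', hb'', hbb''⟩ := h1 b' hb'
    have := (mem_reduce_fst.mp hb).2 b'' (mem_reduce_fst.mp hb'').1 (hbb''.trans hbb')
    subst this
    rwa [Below.antisymm hbb'' hbb']
  exact Finset.Subset.antisymm (key s s' h1 h2) (key s' s h2 h1)

/-- Old elements always keep something below them, so a reduced set can change only through an
element above no old one. Two rounds appear because an arbitrary `s` need not be reduced. -/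
theorem exists_not_below_of_ne {h : Coord n → ℤ} {s : WorkingSets n}
    (hne : (fullRound h (fullRound h s)).1 ≠ (fullRound h s).1) :
    ∃ z ∈ (fullRound h (fullRound h s)).1, ∀ b ∈ (fullRound h s).1, ¬ Below h b z := by
  by_contra hc
  push Not at hc
  exact hne (eq_of_below_below hc fun b hb => exists_mem_fullRound_fst_below h hb).symm

theorem exists_mem_iterate_fst_below (h : Coord n → ℤ) {s : WorkingSets n} {b : Coord n → ℤ}
    (hb : b ∈ s.1) (j : ℕ) : ∃ b' ∈ ((fullRound h)^[j] s).1, Below h b' b := by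
  induction j with
  | zero => exact ⟨b, hb, .refl h b⟩
  | succ j ih =>
    obtain ⟨b', hb', hbb'⟩ := ih
    rw [Function.iterate_succ_apply']
    obtain ⟨b'', hb'', hbb''⟩ := exists_mem_fullRound_fst_below h hb'
    exact ⟨b'', hb'', hbb''.trans hbb'⟩

theorem iterate_fullRound_swap (h : Coord n → ℤ) (s : WorkingSets n) (j : ℕ) :
    (fullRound (-h))^[j] s.swap = ((fullRound h)^[j] s).swap := by
  induction j with
  | zero => rfl
  | succ j ih => rw [Function.iterate_succ_apply', Function.iterate_succ_apply', ih, fullRound_swap]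

theorem Invariant.iterate {P : Set (Coord n → ℤ)} (hP : IsIntCone P) {h : Coord n → ℤ}
    {s : WorkingSets n} (hs : Invariant P h s) (j : ℕ) :
    Invariant P h ((NormalSurfaces.fullRound h)^[j] s) := by
  induction j with
  | zero => exact hs
  | succ j ih => rw [Function.iterate_succ_apply']; exact ih.fullRound hP

/-- The order of a half-cone is a well-quasi-order. -/
theorem exists_lt_below {P : Set (Coord n → ℤ)} (hP : IsIntCone P) (h : Coord n → ℤ)
    (z : ℕ → Coord n → ℤ) (e : ℕ → Bool)
    (hz : ∀ j, z j ∈ half (bif e j then h else -h) P) :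
    ∃ i j, i < j ∧ e i = e j ∧ Below (bif e j then h else -h) (z i) (z j) := by
  -- Dickson's lemma for the coordinates together with the value of the functional, stored at
  -- `none`; the `Bool` records which half-cone is meant.
  have hwqo : WellQuasiOrdered (fun a b : (Option (Coord n) → ℕ) × Bool =>
      a.1 ≤ b.1 ∧ a.2 = b.2) :=
    WellQuasiOrdered.prod (WellQuasiOrdered.pi fun _ => wellQuasiOrdered_le)
      (Finite.wellQuasiOrdered (· = ·))
  obtain ⟨i, j, hij, h1, h2⟩ := hwqo fun j =>
    (fun o => o.elim ((bif e j then h else -h) ⬝ᵥ z j).toNat fun c => (z j c).toNat, e j)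
  simp only at h2
  refine ⟨i, j, hij, h2, fun c => ?_, ?_⟩
  · have h5 : (z i c).toNat ≤ (z j c).toNat := h1 (some c)
    have h3 : 0 ≤ z i c := hP.nonneg _ (hz i).1 c
    have h4 : 0 ≤ z j c := hP.nonneg _ (hz j).1 c
    change z i c ≤ z j c
    omega
  · have h5 : ((bif e i then h else -h) ⬝ᵥ z i).toNat ≤ ((bif e j then h else -h) ⬝ᵥ z j).toNat :=
      h1 none
    have h3 := (hz i).2
    have h4 := (hz j).2
    rw [h2] at h5 h3
    omega

/-- Otherwise each round gives a `z j` above nothing in the preceding set. The well-quasi-order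
yields `i < j` with `z i` below `z j`. But something below `z i` persists in all later rounds, in
particular in the one just before `z j` appears. -/
theorem exists_iterate_stable {P : Set (Coord n → ℤ)} (hP : IsIntCone P) {h : Coord n → ℤ}
    {s : WorkingSets n} (hs : Invariant P h s) :
    ∃ j, fullRound h ((fullRound h)^[j] s) = (fullRound h)^[j] s := by
  by_contra hc
  push Not at hc
  have step : ∀ j, ∃ (z : Coord n → ℤ) (e : Bool),
      z ∈ (bif e then (fullRound h)^[j + 2] s else ((fullRound h)^[j + 2] s).swap).1 ∧
        ∀ b ∈ (bif e then (fullRound h)^[j + 1] s else ((fullRound h)^[j + 1] s).swap).1,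
          ¬ Below (bif e then h else -h) b z := by
    intro j
    have hne := hc (j + 1)
    rw [Function.iterate_succ_apply' (n := j + 1), Function.iterate_succ_apply' (n := j)]
    rw [Function.iterate_succ_apply' (n := j)] at hne
    set s' := (fullRound h)^[j] s
    by_cases h1 : (fullRound h (fullRound h s')).1 = (fullRound h s').1
    · have h2 : (fullRound h (fullRound h s')).2 ≠ (fullRound h s').2 :=
        fun h2 => hne (Prod.ext h1 h2)
      obtain ⟨z, hz, hb⟩ := exists_not_below_of_ne (h := -h) (s := s'.swap)
        (by simpa only [fullRound_swap, Prod.fst_swap] using h2)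
      rw [fullRound_swap] at hz hb
      rw [fullRound_swap] at hz
      exact ⟨z, false, hz, hb⟩
    · obtain ⟨z, hz, hb⟩ := exists_not_below_of_ne h1
      exact ⟨z, true, hz, hb⟩
  choose z e hz hb using step
  obtain ⟨i, j, hij, he, hbel⟩ := exists_lt_below hP h z e (fun j => by
    have := hs.iterate hP (j + 2)
    have hzj := hz j
    cases hej : e j
    · rw [hej] at hzj; exact this.2.mem_half _ hzj
    · rw [hej] at hzj; exact this.1.mem_half _ hzj)
  have hzi := hz i
  have hbj := hb j
  rw [he] at hzi
  obtain ⟨k, rfl⟩ := Nat.exists_eq_add_of_lt hij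
  cases hej : e (i + k + 1)
  · rw [hej] at hzi hbj hbel
    obtain ⟨b, hb1, hb2⟩ := exists_mem_iterate_fst_below (-h) hzi k
    refine hbj b ?_ (hb2.trans hbel)
    simp only [cond_false] at hb1 ⊢
    rw [iterate_fullRound_swap, ← Function.iterate_add_apply] at hb1
    rwa [show i + k + 1 + 1 = k + (i + 2) by omega]
  · rw [hej] at hzi hbj hbel
    obtain ⟨b, hb1, hb2⟩ := exists_mem_iterate_fst_below h hzi k
    refine hbj b ?_ (hb2.trans hbel)
    simp only [cond_true] at hb1 ⊢
    rw [← Function.iterate_add_apply] at hb1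
    rwa [show i + k + 1 + 1 = k + (i + 2) by omega]

/-- The loop stops at the first stable round, which may precede round `j`. -/
theorem mem_roundLoop_of_iterate_stable {h : Coord n → ℤ} (j : ℕ) (s : WorkingSets n)
    (hj : fullRound h ((fullRound h)^[j] s) = (fullRound h)^[j] s) :
    ∃ s' ∈ roundLoop h s, ∃ i, s' = (fullRound h)^[i] s ∧ fullRound h s' = s' := by
  induction j generalizing s with
  | zero =>
    refine ⟨s, ?_, 0, rfl, hj⟩
    refine PFun.fix_stop ?_
    simp only [Function.iterate_zero, id_eq] at hj
    simp [hj]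
  | succ j ih =>
    by_cases hst : fullRound h s = s
    · refine ⟨s, ?_, 0, rfl, hst⟩
      refine PFun.fix_stop ?_
      simp [hst]
    · obtain ⟨s', hs', i, hi, hstab⟩ := ih (fullRound h s) hj
      refine ⟨s', ?_, i + 1, hi, hstab⟩
      refine PFun.mem_fix_iff.mpr (Or.inr ⟨fullRound h s, ?_, hs'⟩)
      simp [hst]

/-- The modified inductive step terminates, and computes the admissible part of the Hilbert basis of
the intersection with a hyperplane. -/
theorem exists_mem_roundLoop {P : Set (Coord n → ℤ)} (hP : IsIntCone P) (h : Coord n → ℤ)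
    {B : Finset (Coord n → ℤ)} (hB : ∀ x, x ∈ B ↔ x ∈ irred P ∧ QuadConstraints x) :
    ∃ s ∈ roundLoop h (initialSets h B), ∀ x, x ∈ s.1 ∩ s.2 ↔
      x ∈ irred {y | y ∈ P ∧ h ⬝ᵥ y = 0} ∧ QuadConstraints x := by
  have hinv : Invariant P h (initialSets h B) := by
    constructor
    · refine ⟨fun x hx => ?_, fun x hx => ?_, fun x hx => ?_, fun x hx hq h0 => ?_⟩
      · rw [initialSets, Finset.mem_filter, hB] at hx
        exact ⟨hx.1.1.1, hx.2⟩
      · rw [initialSets, Finset.mem_filter, hB] at hx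
        exact hx.1.1.2.1
      · rw [initialSets, Finset.mem_filter, hB] at hx
        exact hx.1.2
      · rw [initialSets, Finset.mem_filter, hB]
        exact ⟨⟨hx, hq⟩, h0⟩
    · refine ⟨fun x hx => ?_, fun x hx => ?_, fun x hx => ?_, fun x hx hq h0 => ?_⟩
      · rw [initialSets, Finset.mem_filter, hB] at hx
        exact ⟨hx.1.1.1, by rw [neg_dotProduct]; have := hx.2; omega⟩
      · rw [initialSets, Finset.mem_filter, hB] at hx
        exact hx.1.1.2.1
      · rw [initialSets, Finset.mem_filter, hB] at hx
        exact hx.1.2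
      · rw [initialSets, Finset.mem_filter, hB]
        rw [neg_dotProduct] at h0
        exact ⟨⟨hx, hq⟩, by omega⟩
  obtain ⟨j, hj⟩ := exists_iterate_stable hP hinv
  obtain ⟨s, hs, i, rfl, hstab⟩ := mem_roundLoop_of_iterate_stable j _ hj
  have hi := hinv.iterate hP i
  refine ⟨_, hs, fun x => ?_⟩
  have h2 := mem_fst_iff_of_stable hP hi.swap (by rw [fullRound_swap, hstab]) (z := x)
  rw [Prod.fst_swap] at h2
  rw [Finset.mem_inter, mem_fst_iff_of_stable hP hi hstab, h2, mem_irred_hyperplane_iff]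
  tauto

end Rounds

/-! ### The dual algorithm -/

section DualAlgorithm

variable {n m : ℕ}

theorem mem_intPoints_partialCone {A : Matrix (Fin m) (Coord n) ℤ} {k : ℕ} {x : Coord n → ℤ} :
    x ∈ intPoints (partialCone A k) ↔ (∀ i : Fin m, (i : ℕ) < k → A i ⬝ᵥ x = 0) ∧ 0 ≤ x := by
  simp only [intPoints, partialCone, Set.mem_ofPred_eq, Pi.le_def, Pi.zero_apply, dotProduct]
  norm_cast

theorem isIntCone_intPoints_partialCone (A : Matrix (Fin m) (Coord n) ℤ) (k : ℕ) :
    IsIntCone (intPoints (partialCone A k)) := by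
  refine ⟨fun x hx => (mem_intPoints_partialCone.mp hx).2, fun x hx y hy => ?_,
    fun x hx y hy hxy => ?_⟩
  · rw [mem_intPoints_partialCone] at hx hy ⊢
    exact ⟨fun i hi => by rw [dotProduct_add, hx.1 i hi, hy.1 i hi, add_zero],
      add_nonneg hx.2 hy.2⟩
  · rw [mem_intPoints_partialCone] at hx hy ⊢
    exact ⟨fun i hi => by rw [dotProduct_sub, hx.1 i hi, hy.1 i hi, sub_zero],
      sub_nonneg.mpr hxy⟩

theorem intPoints_partialCone_succ (A : Matrix (Fin m) (Coord n) ℤ) (i : Fin m) :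
    intPoints (partialCone A (i + 1)) = {y | y ∈ intPoints (partialCone A i) ∧ A i ⬝ᵥ y = 0} := by
  ext x
  simp only [Set.mem_ofPred_eq, mem_intPoints_partialCone]
  constructor
  · rintro ⟨h1, h2⟩
    exact ⟨⟨fun j hj => h1 j (by omega), h2⟩, h1 i (by omega)⟩
  · rintro ⟨⟨h1, h2⟩, h3⟩
    refine ⟨fun j hj => ?_, h2⟩
    rcases Nat.lt_succ_iff_lt_or_eq.mp hj with hj | hj
    · exact h1 j hj
    · rwa [Fin.ext hj]

theorem mem_irred_intPoints_partialCone_zero (A : Matrix (Fin m) (Coord n) ℤ) {x : Coord n → ℤ} :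
    x ∈ irred (intPoints (partialCone A 0)) ↔ ∃ c, Pi.single c 1 = x := by
  have hmem : ∀ y : Coord n → ℤ, y ∈ intPoints (partialCone A 0) ↔ 0 ≤ y := by
    simp [mem_intPoints_partialCone]
  constructor
  · rintro ⟨hx, hx0, hirr⟩
    obtain ⟨c, hc⟩ := Function.ne_iff.mp hx0
    rw [hmem] at hx
    have hc1 : 1 ≤ x c := by
      have : 0 ≤ x c := hx c
      simp only [Pi.zero_apply] at hc
      omega
    have hs : (0 : Coord n → ℤ) ≤ Pi.single c 1 := by simp
    have := hirr (Pi.single c 1) ((hmem _).mpr hs) (x - Pi.single c 1) ?_ (by abel)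
    · rcases this with h0 | h0
      · simp at h0
      · exact ⟨c, (sub_eq_zero.mp h0).symm⟩
    · rw [hmem]
      intro d
      have := hx d
      by_cases hd : d = c
      · subst hd; simpa using hc1
      · simpa [hd] using this
  · rintro ⟨c, rfl⟩
    refine ⟨by rw [hmem]; simp, by simp, fun y hy z hz hyz => ?_⟩
    rw [hmem] at hy hz
    have hne : ∀ d, d ≠ c → y d = 0 ∧ z d = 0 := fun d hd => by
      have h1 := congrFun hyz d
      have h2 := hy d
      have h3 := hz d
      simp [hd] at h1 h2 h3
      omega
    have h1 := congrFun hyz c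
    have h2 := hy c
    have h3 := hz c
    simp only [Pi.single_eq_same, Pi.add_apply, Pi.zero_apply] at h1 h2 h3
    rcases (by omega : y c = 0 ∨ z c = 0) with h | h
    · left; funext d
      by_cases hd : d = c
      · rw [hd]; exact h
      · exact (hne d hd).1
    · right; funext d
      by_cases hd : d = c
      · rw [hd]; exact h
      · exact (hne d hd).2

theorem quadConstraints_single (c : Coord n) : QuadConstraints (Pi.single c 1 : Coord n → ℤ) := by
  intro t q q' hq hq'
  have h1 : (t, Sum.inr q) = c := by by_contra h; exact hq (Pi.single_eq_of_ne h _)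
  have h2 : (t, Sum.inr q') = c := by by_contra h; exact hq' (Pi.single_eq_of_ne h _)
  simpa using h1.trans h2.symm

/-- The dual algorithm terminates, and its candidate bases are the admissible parts of the Hilbert
bases of the partial cones. -/
theorem exists_mem_candidateBasis (A : Matrix (Fin m) (Coord n) ℤ) (k : Fin (m + 1)) :
    ∃ B ∈ candidateBasis A k,
      (B : Set (Coord n → ℤ)) = {x | x ∈ hilb (partialCone A k) ∧ QuadConstraints x} := by
  induction k using Fin.induction with
  | zero =>
    refine ⟨Finset.univ.image fun c => Pi.single c 1, Part.mem_some _, ?_⟩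
    ext x
    change _ ↔ x ∈ irred (intPoints (partialCone A 0)) ∧ QuadConstraints x
    rw [mem_irred_intPoints_partialCone_zero]
    simp only [Finset.coe_image, Finset.coe_univ, Set.image_univ, Set.mem_range]
    refine ⟨fun h => ⟨h, ?_⟩, fun h => h.1⟩
    obtain ⟨c, rfl⟩ := h
    exact quadConstraints_single c
  | succ i ih =>
    obtain ⟨B, hB, hBeq⟩ := ih
    obtain ⟨s, hs, hseq⟩ := exists_mem_roundLoop
      (isIntCone_intPoints_partialCone A (i : ℕ)) (A i) (B := B) fun x => by
        rw [← Finset.mem_coe, hBeq]; rfl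
    refine ⟨s.1 ∩ s.2, ?_, ?_⟩
    · rw [candidateBasis, Fin.induction_succ]
      exact Part.mem_bind hB (Part.mem_map _ hs)
    · ext x
      rw [Finset.mem_coe, hseq, ← intPoints_partialCone_succ]
      rfl

end DualAlgorithm

/-! ### Normal arcs in coordinates -/

section Arcs

/-- The vertices of the tetrahedron in some order. -/
def Distinct4 (a b c f : Fin 4) : Prop := a ≠ b ∧ a ≠ c ∧ a ≠ f ∧ b ≠ c ∧ b ≠ f ∧ c ≠ f

instance (a b c f : Fin 4) : Decidable (Distinct4 a b c f) := inferInstanceAs (Decidable (_ ∧ _))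

theorem exists_distinct4 : ∀ {a b c : Fin 4}, a ≠ b → a ≠ c → b ≠ c → ∃ f, Distinct4 a b c f := by
  decide

theorem Distinct4.cover : ∀ {a b c f : Fin 4}, Distinct4 a b c f →
    ∀ v, v = a ∨ v = b ∨ v = c ∨ v = f := by
  decide

theorem Distinct4.swap {a b c f : Fin 4} (H : Distinct4 a b c f) : Distinct4 a c b f := by
  obtain ⟨h1, h2, h3, h4, h5, h6⟩ := H
  exact ⟨h2, h1, h3, h4.symm, h6, h5⟩

theorem Distinct4.rotate {a b c f : Fin 4} (H : Distinct4 a b c f) : Distinct4 b a c f := by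
  obtain ⟨h1, h2, h3, h4, h5, h6⟩ := H
  exact ⟨h1.symm, h4, h5, h2, h3, h6⟩

theorem Distinct4.flip {a b c f : Fin 4} (H : Distinct4 a b c f) : Distinct4 a b f c := by
  obtain ⟨h1, h2, h3, h4, h5, h6⟩ := H
  exact ⟨h1, h3, h2, h5, h4, h6.symm⟩

theorem Distinct4.eq_or_eq {a b c f b' c' : Fin 4} (H : Distinct4 a b c f)
    (H' : Distinct4 a b' c' f) : (b' = b ∧ c' = c) ∨ (b' = c ∧ c' = b) := by
  obtain ⟨h1, h2, h3, h4, h5, h6⟩ := H'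
  rcases H.cover b' with rfl | rfl | rfl | rfl <;> rcases H.cover c' with rfl | rfl | rfl | rfl <;>
    simp_all

theorem DiscType.Separates.ne {d : DiscType} {a b : Fin 4} (h : d.Separates a b) : a ≠ b := by
  rintro rfl
  exact h rfl

theorem DiscType.Separates.symm {d : DiscType} {a b : Fin 4} (h : d.Separates a b) :
    d.Separates b a := Ne.symm h

theorem DiscType.Separates.or {d : DiscType} {a b : Fin 4} (h : d.Separates a b) (c : Fin 4) :
    d.Separates a c ∨ d.Separates b c := by
  by_contra hc
  simp only [DiscType.Separates, not_or, not_not] at hc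
  exact h (hc.1.trans hc.2.symm)

/-- The point at distance ratio `r` from `a` on the edge `ab`. -/
noncomputable def edgePoint (a b : Fin 4) (r : ℝ) : Fin 4 → ℝ :=
  (1 - r) • vertexPoint a + r • vertexPoint b

theorem edgePoint_symm (a b : Fin 4) (r : ℝ) : edgePoint a b r = edgePoint b a (1 - r) := by
  simp [edgePoint, add_comm]

/-- Coordinates of the points of the segment between a point of `ab` and a point of `ac`. -/
theorem mem_segment_edgePoint_iff {a b c f : Fin 4} (H : Distinct4 a b c f) {s t : ℝ}
    {p : Fin 4 → ℝ} : p ∈ segment ℝ (edgePoint a b s) (edgePoint a c t) ↔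
      ∃ l : ℝ, 0 ≤ l ∧ l ≤ 1 ∧ p a = 1 - l * s - (1 - l) * t ∧ p b = l * s ∧ p c = (1 - l) * t ∧
        p f = 0 := by
  have hcov := H.cover
  obtain ⟨h1, h2, h3, h4, h5, h6⟩ := H
  constructor
  · rintro ⟨l, m, hl, hm, hlm, rfl⟩
    obtain rfl : m = 1 - l := by linarith
    refine ⟨l, hl, by linarith, ?_, ?_, ?_, ?_⟩
    · simp [edgePoint, vertexPoint, h1, h2]; ring
    · simp [edgePoint, vertexPoint, h1.symm, h4]
    · simp [edgePoint, vertexPoint, h2.symm, h4.symm]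
    · simp [edgePoint, vertexPoint, h3.symm, h5.symm, h6.symm]
  · rintro ⟨l, hl, hl1, ha, hb, hc, hf⟩
    refine ⟨l, 1 - l, hl, by linarith, by ring, ?_⟩
    funext v
    rcases hcov v with rfl | rfl | rfl | rfl
    · rw [ha]; simp [edgePoint, vertexPoint, h1, h2]; ring
    · rw [hb]; simp [edgePoint, vertexPoint, h1.symm, h4]
    · rw [hc]; simp [edgePoint, vertexPoint, h2.symm, h4.symm]
    · rw [hf]; simp [edgePoint, vertexPoint, h3.symm, h5.symm, h6.symm]

theorem eq_edgePoint_of_mem_segment {a b c f : Fin 4} (H : Distinct4 a b c f) {s t : ℝ}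
    (hs : s ≠ 0) {p : Fin 4 → ℝ} (hp : p ∈ segment ℝ (edgePoint a b s) (edgePoint a c t))
    (hpb : p b = 0) : p = edgePoint a c t := by
  obtain ⟨l, -, -, pa, pb, pc, pf⟩ := (mem_segment_edgePoint_iff H).mp hp
  have hcov := H.cover
  obtain ⟨h1, h2, h3, h4, h5, h6⟩ := H
  obtain rfl : l = 0 := (mul_eq_zero.mp (pb.symm.trans hpb)).resolve_right hs
  funext v
  rcases hcov v with rfl | rfl | rfl | rfl
  · rw [pa]; simp [edgePoint, vertexPoint, h2]
  · rw [pb]; simp [edgePoint, vertexPoint, h1.symm, h4]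
  · rw [pc]; simp [edgePoint, vertexPoint, h2.symm]
  · rw [pf]; simp [edgePoint, vertexPoint, h3.symm, h6.symm]

/-- Two arcs around the same vertex are disjoint if they meet its edges in the same order. -/
theorem disjoint_arcs_same {a b c f : Fin 4} (H : Distinct4 a b c f) {s t s' t' : ℝ}
    (hs : 0 < s) (ht : 0 < t) (hss : s < s') (htt : t < t') {p : Fin 4 → ℝ}
    (hp : p ∈ segment ℝ (edgePoint a b s) (edgePoint a c t))
    (hp' : p ∈ segment ℝ (edgePoint a b s') (edgePoint a c t')) : False := by
  rw [mem_segment_edgePoint_iff H] at hp hp'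
  obtain ⟨l, hl0, hl1, -, hb, hc, -⟩ := hp
  obtain ⟨m, hm0, hm1, -, hb', hc', -⟩ := hp'
  rw [hb] at hb'
  rw [hc] at hc'
  -- The `b`-coordinates give `l * s = m * s'`, the `c`-coordinates `(1 - l) * t = (1 - m) * t'`.
  -- The first forces `m ≤ l`, the second `l ≤ m`, and equality is impossible.
  have h1 : m ≤ l := by
    by_contra h
    push Not at h
    nlinarith [mul_lt_mul_of_pos_right h (hs.trans hss), mul_le_mul_of_nonneg_left hss.le hl0]
  have h2 : l ≤ m := by
    by_contra h
    push Not at h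
    have : (1 - l) * t' < (1 - m) * t' := mul_lt_mul_of_pos_right (by linarith) (ht.trans htt)
    nlinarith [mul_le_mul_of_nonneg_left htt.le (by linarith : (0 : ℝ) ≤ 1 - l)]
  obtain rfl := le_antisymm h1 h2
  have h3 : m * (s' - s) = 0 := by linarith
  have h4 : (1 - m) * (t' - t) = 0 := by linarith
  rcases mul_eq_zero.mp h3 with h | h
  · rcases mul_eq_zero.mp h4 with h' | h' <;> linarith
  · linarith

/-- Arcs around `a` and around `b` are disjoint if they meet the edge `ab` in this order. -/
theorem disjoint_arcs_ne {a b c f : Fin 4} (H : Distinct4 a b c f) {s t s' u : ℝ}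
    (hs : 0 < s) (hs' : 0 < s') (ht1 : t < 1) (hu1 : u < 1) (hss : s + s' < 1)
    {p : Fin 4 → ℝ}
    (hp : p ∈ segment ℝ (edgePoint a b s) (edgePoint a c t))
    (hp' : p ∈ segment ℝ (edgePoint b a s') (edgePoint b c u)) : False := by
  rw [mem_segment_edgePoint_iff H] at hp
  rw [mem_segment_edgePoint_iff H.rotate] at hp'
  obtain ⟨l, hl0, hl1, ha, hb, hc, -⟩ := hp
  obtain ⟨m, hm0, hm1, hb', ha', hc', -⟩ := hp'
  rw [hb] at hb'
  rw [ha] at ha'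
  have h1 : m < l := by
    by_contra h
    push Not at h
    have e1 : l * s = m * (1 - s') + (1 - m) * (1 - u) := by linarith
    have e2 : 0 ≤ (1 - m) * (1 - u) := mul_nonneg (by linarith) (by linarith)
    have e3 : l * s ≤ m * s := mul_le_mul_of_nonneg_right h hs.le
    have e4 : m * (1 - s' - s) ≤ 0 := by linarith
    have e5 : m = 0 := by
      by_contra hm
      have := mul_pos (lt_of_le_of_ne hm0 (Ne.symm hm)) (by linarith : 0 < 1 - s' - s)
      linarith
    subst e5
    obtain rfl : l = 0 := by linarith
    linarith
  have h2 : l < m := by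
    by_contra h
    push Not at h
    have e1 : m * s' = l * (1 - s) + (1 - l) * (1 - t) := by linarith
    have e2 : 0 ≤ (1 - l) * (1 - t) := mul_nonneg (by linarith) (by linarith)
    have e3 : m * s' ≤ l * s' := mul_le_mul_of_nonneg_right h hs'.le
    have e5 := mul_pos (lt_of_le_of_lt hm0 h1) (by linarith : 0 < 1 - s - s')
    linarith
  linarith

/-- Otherwise they intersect. -/
theorem exists_mem_arcs {a b c f : Fin 4} (H : Distinct4 a b c f) {s t s' u : ℝ}
    (hs : 0 < s) (hs1 : s < 1) (ht : 0 < t) (ht1 : t < 1) (hs' : 0 < s') (hs'1 : s' < 1)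
    (hu : 0 < u) (hu1 : u < 1) (hss : 1 ≤ s + s') :
    ∃ p : Fin 4 → ℝ, p ∈ segment ℝ (edgePoint a b s) (edgePoint a c t) ∧
      p ∈ segment ℝ (edgePoint b a s') (edgePoint b c u) := by
  -- Solving for the common point gives the weights `u * w` on the `ac` end and `t * w` on the `bc`
  -- end, with `w = (s + s' - 1) / E`. The bounds `k1` and `k2` say that `E > 0` and that both
  -- weights are at most `1`.
  have k1 : t * (s + s' - 1) < s * u + s' * t - u * t := by
    have e1 := mul_pos (mul_pos (by linarith : 0 < 1 - t) hs) hu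
    have e2 := mul_pos (mul_pos ht (by linarith : 0 < 1 - u)) (by linarith : 0 < 1 - s)
    nlinarith
  have k2 : u * (s + s' - 1) ≤ s * u + s' * t - u * t := by
    have e1 := mul_pos (mul_pos hu (by linarith : 0 < 1 - t)) (by linarith : 0 < 1 - s')
    have e2 := mul_pos (mul_pos hs' ht) (by linarith : 0 < 1 - u)
    nlinarith
  have k3 : 0 ≤ t * (s + s' - 1) := mul_nonneg ht.le (by linarith)
  set E := s * u + s' * t - u * t with hE
  have hE0 : 0 < E := by linarith
  have hl : u * (s + s' - 1) / E ≤ 1 := by rw [div_le_one hE0]; exact k2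
  have hm : t * (s + s' - 1) / E ≤ 1 := by rw [div_le_one hE0]; exact k1.le
  have hl0 : 0 ≤ u * (s + s' - 1) / E := div_nonneg (mul_nonneg hu.le (by linarith)) hE0.le
  have hm0 : 0 ≤ t * (s + s' - 1) / E := div_nonneg k3 hE0.le
  set w := (s + s' - 1) / E with hw
  have hwE : w * E = s + s' - 1 := div_mul_cancel₀ _ hE0.ne'
  rw [mul_div_assoc] at hl hm hl0 hm0
  refine ⟨(1 - u * w) • edgePoint a b s + (u * w) • edgePoint a c t, ?_, ?_⟩
  · exact ⟨1 - u * w, u * w, by linarith, hl0, by ring, rfl⟩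
  · rw [mem_segment_edgePoint_iff H.rotate]
    obtain ⟨h1, h2, h3, h4, h5, h6⟩ := H
    rw [hE] at hwE
    refine ⟨1 - t * w, by linarith, by linarith, ?_, ?_, ?_, ?_⟩
    · simp [edgePoint, vertexPoint, h1.symm, h4]
      linarith
    · simp [edgePoint, vertexPoint, h1, h2]
      linarith
    · simp [edgePoint, vertexPoint, h2.symm, h4.symm]
      ring
    · simp [edgePoint, vertexPoint, h3.symm, h5.symm, h6.symm]

end Arcs

/-! ### Normal discs in coordinates -/

section Discs

/-- Corner positions: `r a b` is the distance ratio from `a` of the corner on the edge `ab`. -/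
def IsCornerPosition (d : DiscType) (r : Fin 4 → Fin 4 → ℝ) : Prop :=
  ∀ a b, d.Separates a b → 0 < r a b ∧ r a b + r b a = 1

theorem IsCornerPosition.lt_one {d : DiscType} {r : Fin 4 → Fin 4 → ℝ} (hr : IsCornerPosition d r)
    {a b : Fin 4} (h : d.Separates a b) : r a b < 1 := by
  have h1 := hr a b h
  have h2 := hr b a h.symm
  linarith [h1.2, h2.1]

theorem IsCornerPosition.edgePoint_symm {d : DiscType} {r : Fin 4 → Fin 4 → ℝ}
    (hr : IsCornerPosition d r) {a b : Fin 4} (h : d.Separates a b) :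
    edgePoint a b (r a b) = edgePoint b a (r b a) := by
  rw [NormalSurfaces.edgePoint_symm]
  congr 1
  linarith [(hr a b h).2]

/-- The boundary curve of the disc of type `d` with the given corners. -/
def discCurve (d : DiscType) (r : Fin 4 → Fin 4 → ℝ) : Set (Fin 4 → ℝ) :=
  {p | ∃ a b c, b ≠ c ∧ d.Separates a b ∧ d.Separates a c ∧
    p ∈ segment ℝ (edgePoint a b (r a b)) (edgePoint a c (r a c))}

theorem isNormalDisc_iff {d : DiscType} {C : Set (Fin 4 → ℝ)} :
    IsNormalDisc d C ↔ ∃ r, IsCornerPosition d r ∧ C = discCurve d r := by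
  constructor
  · rintro ⟨corner, hcorner, rfl⟩
    have hex : ∀ a b, ∃ r : ℝ, d.Separates a b → (0 < r ∧ r < 1) ∧ corner a b = edgePoint a b r := by
      intro a b
      by_cases h : d.Separates a b
      · obtain ⟨r, hr, hrc⟩ := openSegment_eq_image ℝ (vertexPoint a) (vertexPoint b) ▸
          (hcorner a b h).2
        exact ⟨r, fun _ => ⟨hr, hrc.symm⟩⟩
      · exact ⟨0, fun h' => absurd h' h⟩
    choose r hr using hex
    refine ⟨r, fun a b h => ⟨(hr a b h).1.1, ?_⟩, ?_⟩
    · have h1 := (hcorner a b h).1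
      rw [(hr a b h).2, (hr b a h.symm).2] at h1
      have h2 := congrFun h1 b
      simp [edgePoint, vertexPoint, h.ne.symm] at h2
      linarith
    · ext p
      refine exists_congr fun a => exists_congr fun b => exists_congr fun c =>
        and_congr_right fun _ => and_congr_right fun hb => and_congr_right fun hc => ?_
      rw [(hr a b hb).2, (hr a c hc).2]
  · rintro ⟨r, hr, rfl⟩
    refine ⟨fun a b => edgePoint a b (r a b), fun a b h => ⟨hr.edgePoint_symm h, ?_⟩, rfl⟩
    rw [openSegment_eq_image]
    exact ⟨r a b, ⟨(hr a b h).1, hr.lt_one h⟩, rfl⟩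

theorem edgePoint_mem_discCurve {d : DiscType} {r : Fin 4 → Fin 4 → ℝ}
    (hr : IsCornerPosition d r) {a b : Fin 4} (h : d.Separates a b) :
    edgePoint a b (r a b) ∈ discCurve d r := by
  obtain ⟨c, hca, hcb⟩ : ∃ c, c ≠ a ∧ c ≠ b := by
    clear h; revert a b; decide
  rcases h.or c with hc | hc
  · exact ⟨a, b, c, hcb.symm, h, hc, left_mem_segment ℝ _ _⟩
  · rw [hr.edgePoint_symm h]
    exact ⟨b, a, c, hca.symm, h.symm, hc, left_mem_segment ℝ _ _⟩

/-- This is the `a`-coordinate along an arc around `a`: the arc avoids the edge opposite `a`. -/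
theorem arc_center_pos {l s t : ℝ} (hl0 : 0 ≤ l) (hl1 : l ≤ 1) (hs : s < 1) (ht : t < 1) :
    0 < 1 - l * s - (1 - l) * t := by
  have h1 : 0 ≤ l * (1 - s) := mul_nonneg hl0 (by linarith)
  have h2 : 0 ≤ (1 - l) * (1 - t) := mul_nonneg (by linarith) (by linarith)
  rcases eq_or_lt_of_le hl0 with rfl | h
  · linarith
  · have := mul_pos h (by linarith : 0 < 1 - s)
    linarith

/-- The trace of a disc on a face consists of its arcs in this face. -/
theorem exists_arc_of_mem_discCurve {d : DiscType} {r : Fin 4 → Fin 4 → ℝ}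
    (hr : IsCornerPosition d r) {p : Fin 4 → ℝ} (hp : p ∈ discCurve d r) {f : Fin 4}
    (hf : p f = 0) : ∃ a b c, Distinct4 a b c f ∧ d.Separates a b ∧ d.Separates a c ∧
      p ∈ segment ℝ (edgePoint a b (r a b)) (edgePoint a c (r a c)) := by
  -- A point of the face opposite `f` may come from an arc in another face. It is then a corner on
  -- the common edge, and the disc also has an arc in the face opposite `f` ending there.
  have corner : ∀ a b c, Distinct4 a b f c → d.Separates a b →
      p = edgePoint a b (r a b) → ∃ a b c, Distinct4 a b c f ∧ d.Separates a b ∧ d.Separates a c ∧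
      p ∈ segment ℝ (edgePoint a b (r a b)) (edgePoint a c (r a c)) := by
    intro a b c H h hpe
    rcases h.or c with hc | hc
    · exact ⟨a, b, c, H.flip, h, hc, hpe ▸ left_mem_segment ℝ _ _⟩
    · rw [hr.edgePoint_symm h] at hpe
      exact ⟨b, a, c, H.flip.rotate, h.symm, hc, hpe ▸ left_mem_segment ℝ _ _⟩
  obtain ⟨a, b, c, hbc, hb, hc, hp⟩ := hp
  obtain ⟨g, H⟩ := exists_distinct4 hb.ne hc.ne hbc
  obtain ⟨l, hl0, hl1, pa, pb, pc, pg⟩ := (mem_segment_edgePoint_iff H).mp hp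
  rcases H.cover f with rfl | rfl | rfl | rfl
  · rw [hf] at pa
    exact absurd pa (arc_center_pos hl0 hl1 (hr.lt_one hb) (hr.lt_one hc)).ne
  · exact corner a c g H.swap hc (eq_edgePoint_of_mem_segment H (hr _ _ hb).1.ne' hp hf)
  · rw [segment_symm] at hp
    exact corner a b g H hb (eq_edgePoint_of_mem_segment H.swap (hr _ _ hc).1.ne' hp hf)
  · exact ⟨a, b, c, H, hb, hc, hp⟩

theorem exists_face_of_mem_discCurve {d : DiscType} {r : Fin 4 → Fin 4 → ℝ} {p : Fin 4 → ℝ}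
    (hp : p ∈ discCurve d r) : ∃ f, p f = 0 := by
  obtain ⟨a, b, c, hbc, hb, hc, hp⟩ := hp
  obtain ⟨f, H⟩ := exists_distinct4 hb.ne hc.ne hbc
  obtain ⟨l, -, -, -, -, -, pf⟩ := (mem_segment_edgePoint_iff H).mp hp
  exact ⟨f, pf⟩

/-- A disc meets an edge only in its corner on this edge. -/
theorem separates_and_eq_of_mem_discCurve {d : DiscType} {r : Fin 4 → Fin 4 → ℝ}
    (hr : IsCornerPosition d r) {p : Fin 4 → ℝ} (hp : p ∈ discCurve d r) {a b : Fin 4}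
    (hab : a ≠ b) (he : ∀ c, c ≠ a → c ≠ b → p c = 0) :
    d.Separates a b ∧ p = edgePoint a b (r a b) := by
  obtain ⟨c, hca, hcb⟩ : ∃ c, c ≠ a ∧ c ≠ b := by
    clear he; revert a b; decide
  obtain ⟨f, H⟩ := exists_distinct4 hab hca.symm hcb.symm
  obtain ⟨a', b', c', H', hb, hc, hp⟩ := exists_arc_of_mem_discCurve hr hp
    (he f H.2.2.1.symm H.2.2.2.2.1.symm)
  obtain ⟨l, hl0, hl1, pa, pb, pc, pf⟩ := (mem_segment_edgePoint_iff H').mp hp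
  have mem : ∀ v, p v ≠ 0 → v = a ∨ v = b := fun v hv => by
    by_contra h
    push Not at h
    exact hv (he v h.1 h.2)
  have ha := mem a' (pa ▸ (arc_center_pos hl0 hl1 (hr.lt_one hb) (hr.lt_one hc)).ne')
  have key : ∀ v, (v = a ∨ v = b) → d.Separates a' v → p = edgePoint a' v (r a' v) →
      d.Separates a b ∧ p = edgePoint a b (r a b) := by
    intro v hv h hpe
    rcases ha with rfl | rfl <;> rcases hv with rfl | rfl
    · exact absurd rfl h.ne
    · exact ⟨h, hpe⟩
    · exact ⟨h.symm, by rw [hr.edgePoint_symm h.symm]; exact hpe⟩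
    · exact absurd rfl h.ne
  -- The support of `p` lies in `{a, b}` and contains `a'`, so `p` is an end of its arc.
  have hzero : p b' = 0 ∨ p c' = 0 := by
    by_contra h
    push Not at h
    obtain ⟨h1, h2, -, h4, -⟩ := H'
    rcases ha with rfl | rfl <;> rcases mem b' h.1 with rfl | rfl
    · exact h1 rfl
    · exact h.2 (he c' h2.symm h4.symm)
    · exact h.2 (he c' h4.symm h2.symm)
    · exact h1 rfl
  have hsb := (hr _ _ hb).1.ne'
  have hsc := (hr _ _ hc).1.ne'
  have hpa : ∀ v, d.Separates a' v → p = edgePoint a' v (r a' v) → p v ≠ 0 := by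
    intro v h hpe
    rw [hpe]
    simpa [edgePoint, vertexPoint, h.ne.symm] using (hr _ _ h).1.ne'
  rcases hzero with h | h
  · have hpe := eq_edgePoint_of_mem_segment H' hsb hp h
    exact key c' (mem c' (hpa c' hc hpe)) hc hpe
  · rw [segment_symm] at hp
    have hpe := eq_edgePoint_of_mem_segment H'.swap hsc hp h
    exact key b' (mem b' (hpa b' hb hpe)) hb hpe

end Discs

/-! ### Arc counts -/

section Counts

variable {M : Type*} [AddCommGroup M]

/-- The number of arcs around the vertex `v` in the face opposite `f`. -/
def cutCount (X : DiscType → M) (f v : Fin 4) : M := ∑ d, if d.CutsOff f v then X d else 0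

/-- The number of corners on the edge `ab`. -/
def edgeCount (X : DiscType → M) (a b : Fin 4) : M := ∑ d, if d.Separates a b then X d else 0

theorem edgeCount_comm (X : DiscType → M) (a b : Fin 4) : edgeCount X a b = edgeCount X b a :=
  Finset.sum_congr rfl fun _ _ => if_congr ⟨fun h => h.symm, fun h => h.symm⟩ rfl rfl

theorem separates_iff_cutsOff (d : DiscType) : ∀ {a b f : Fin 4}, a ≠ b → a ≠ f → b ≠ f →
    ((d.Separates a b ↔ d.CutsOff f a ∨ d.CutsOff f b) ∧ ¬ (d.CutsOff f a ∧ d.CutsOff f b)) := by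
  revert d; decide

/-- Within a face, each corner on an edge is an end of exactly one arc, which goes around one of the
two ends of the edge. -/
theorem edgeCount_eq (X : DiscType → M) {a b f : Fin 4} (hab : a ≠ b) (haf : a ≠ f) (hbf : b ≠ f) :
    edgeCount X a b = cutCount X f a + cutCount X f b := by
  rw [edgeCount, cutCount, cutCount, ← Finset.sum_add_distrib]
  refine Finset.sum_congr rfl fun d _ => ?_
  have h := separates_iff_cutsOff d hab haf hbf
  by_cases h1 : d.CutsOff f a <;> by_cases h2 : d.CutsOff f b <;> simp_all

theorem cutsOff_iff (d : DiscType) : ∀ {a b c f : Fin 4}, Distinct4 a b c f →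
    (d.CutsOff f a ↔ d.Separates a b ∧ d.Separates a c) := by
  revert d; decide

/-- Two disc types cut off a given vertex of a given face. -/
theorem exists_cutsOff_iff {f v : Fin 4} (hv : v ≠ f) :
    ∃ q, ∀ d : DiscType, d.CutsOff f v ↔ d = Sum.inl v ∨ d = Sum.inr q := by
  revert f v; decide

theorem cutCount_eq (X : DiscType → M) {f v : Fin 4} {q : Fin 3}
    (hq : ∀ d : DiscType, d.CutsOff f v ↔ d = Sum.inl v ∨ d = Sum.inr q) :
    cutCount X f v = X (Sum.inl v) + X (Sum.inr q) := by
  simp [cutCount, hq]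

theorem matchingEquation_dotProduct {n : ℕ} (T : Triangulation n) {t t' : Fin n} {f v : Fin 4}
    {σ : Equiv.Perm (Fin 4)} (h : T.glue t f = some (t', σ)) (x : Coord n → ℤ) :
    T.matchingEquation t f v ⬝ᵥ x =
      cutCount (fun d => x (t, d)) f v - cutCount (fun d => x (t', d)) (σ f) (σ v) := by
  have key : ∀ (t : Fin n) (f v : Fin 4),
      ∑ c : Coord n, (if c.1 = t ∧ c.2.CutsOff f v then 1 else 0) * x c =
        cutCount (fun d => x (t, d)) f v := by
    intro t f v
    rw [Fintype.sum_prod_type, Finset.sum_eq_single t]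
    · simp [cutCount]
    · intro t' _ ht'
      simp [ht']
    · simp
  simp only [dotProduct, Triangulation.matchingEquation, h, sub_mul, Finset.sum_sub_distrib, key]

end Counts

/-! ### Vector representations are admissible -/

section Admissible

/-- Both quadrilaterals meet some edge `bc`. In one adjacent face the first cuts off `c` and the
second `b`; in the other face the roles are exchanged. Disjointness in the two faces demands
opposite orders of their corners on `bc`: the two strict inequalities add up to `2 < 2`. -/
theorem not_disjoint_quads {q q' : Fin 3} (hq : q ≠ q') {C C' : Set (Fin 4 → ℝ)}
    (hC : IsNormalDisc (Sum.inr q) C) (hC' : IsNormalDisc (Sum.inr q') C') : ¬ Disjoint C C' := by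
  obtain ⟨r, hr, rfl⟩ := isNormalDisc_iff.mp hC
  obtain ⟨r', hr', rfl⟩ := isNormalDisc_iff.mp hC'
  obtain ⟨b, c, e, f, H, h1, h2, h3, h4, h5, h6⟩ : ∃ b c e f : Fin 4, Distinct4 b c e f ∧
      DiscType.Separates (Sum.inr q) c b ∧ DiscType.Separates (Sum.inr q) c e ∧
      DiscType.Separates (Sum.inr q') b e ∧ DiscType.Separates (Sum.inr q) b f ∧
      DiscType.Separates (Sum.inr q') c f ∧ DiscType.Separates (Sum.inr q') b c := by
    clear hC hC' hr hr' r r'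
    revert q q'; decide
  intro hdis
  have g1 : r c b + r' b c < 1 := by
    by_contra h
    obtain ⟨p, hp, hp'⟩ := exists_mem_arcs (s := r c b) (t := r c e) (s' := r' b c) (u := r' b e)
      H.rotate (hr _ _ h1).1 (hr.lt_one h1) (hr _ _ h2).1
      (hr.lt_one h2) (hr' _ _ h6).1 (hr'.lt_one h6) (hr' _ _ h3).1 (hr'.lt_one h3) (not_lt.mp h)
    exact Set.disjoint_left.mp hdis ⟨c, b, e, H.2.1, h1, h2, hp⟩
      ⟨b, c, e, H.2.2.2.1, h6, h3, hp'⟩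
  have g2 : r b c + r' c b < 1 := by
    by_contra h
    obtain ⟨p, hp, hp'⟩ := exists_mem_arcs (s := r b c) (t := r b f) (s' := r' c b) (u := r' c f)
      H.flip (hr _ _ h1.symm).1 (hr.lt_one h1.symm) (hr _ _ h4).1
      (hr.lt_one h4) (hr' _ _ h6.symm).1 (hr'.lt_one h6.symm) (hr' _ _ h5).1 (hr'.lt_one h5)
      (not_lt.mp h)
    exact Set.disjoint_left.mp hdis ⟨b, c, f, H.2.2.2.2.1, h1.symm, h4, hp⟩
      ⟨c, b, f, H.2.2.1, h6.symm, h5, hp'⟩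
  have := (hr _ _ h1).2
  have := (hr' _ _ h6).2
  linarith

variable {n : ℕ} {T : Triangulation n}

theorem NormalSurface.vec_nonneg (S : NormalSurface T) : 0 ≤ S.vec := fun _ => Nat.cast_nonneg _

theorem NormalSurface.quadConstraints_vec (S : NormalSurface T) : QuadConstraints S.vec := by
  intro t q q' hq hq'
  simp only [NormalSurface.vec, ne_eq, Nat.cast_eq_zero, Finset.card_eq_zero,
    ← Finset.nonempty_iff_ne_empty] at hq hq'
  obtain ⟨C, hC⟩ := hq
  obtain ⟨C', hC'⟩ := hq'
  by_contra hne
  exact not_disjoint_quads hne (S.isNormalDisc _ _ _ hC) (S.isNormalDisc _ _ _ hC')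
    (S.disjoint t _ _ C hC C' hC' (Or.inl (by simpa using hne)))

/-- The points of the surface on the edge `ab` of the tetrahedron `t`. -/
def NormalSurface.edgePoints (S : NormalSurface T) (t : Fin n) (a b : Fin 4) :
    Set (Fin 4 → ℝ) :=
  {p | (∀ c, c ≠ a → c ≠ b → p c = 0) ∧ ∃ d, ∃ C ∈ S.discs t d, p ∈ C}

theorem exists_mem_discCurve_edge {d : DiscType} {r : Fin 4 → Fin 4 → ℝ}
    (hr : IsCornerPosition d r) {a b : Fin 4} (h : d.Separates a b) :
    ∃ p ∈ discCurve d r, ∀ c, c ≠ a → c ≠ b → p c = 0 :=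
  ⟨_, edgePoint_mem_discCurve hr h, fun c hca hcb => by simp [edgePoint, vertexPoint, hca, hcb]⟩

/-- A disc that meets the edge does so in one point, and disjoint discs give different points. -/
theorem NormalSurface.ncard_edgePoints (S : NormalSurface T) (t : Fin n) {a b : Fin 4}
    (hab : a ≠ b) : ((S.edgePoints t a b).ncard : ℤ) = edgeCount (fun d => S.vec (t, d)) a b := by
  classical
  let F : Finset (Σ _ : DiscType, Set (Fin 4 → ℝ)) :=
    (Finset.univ.filter fun d : DiscType => d.Separates a b).sigma (S.discs t)
  have hF : ∀ x, x ∈ F ↔ x.1.Separates a b ∧ x.2 ∈ S.discs t x.1 := fun x => by simp [F]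
  have hex : ∀ x : Σ _ : DiscType, Set (Fin 4 → ℝ), ∃ p : Fin 4 → ℝ, x ∈ F →
      p ∈ x.2 ∧ ∀ c, c ≠ a → c ≠ b → p c = 0 := by
    intro x
    by_cases hx : x ∈ F
    · obtain ⟨r, hr, hC⟩ := isNormalDisc_iff.mp (S.isNormalDisc _ _ _ ((hF x).mp hx).2)
      obtain ⟨p, hp, hpe⟩ := exists_mem_discCurve_edge hr ((hF x).mp hx).1
      exact ⟨p, fun _ => ⟨hC ▸ hp, hpe⟩⟩
    · exact ⟨0, fun h => absurd h hx⟩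
  choose g hg using hex
  have hdisj : ∀ x ∈ F, ∀ y ∈ F, ∀ p, p ∈ x.2 → p ∈ y.2 → x = y := by
    rintro ⟨d, C⟩ hx ⟨d', C'⟩ hy p hp hp'
    by_contra hne
    refine Set.disjoint_left.mp (S.disjoint t d d' C ((hF _).mp hx).2 C' ((hF _).mp hy).2 ?_) hp hp'
    by_contra hc
    push Not at hc
    obtain ⟨rfl, rfl⟩ := hc
    exact hne rfl
  have huniq : ∀ (d : DiscType), ∀ C ∈ S.discs t d, ∀ p ∈ C, ∀ q ∈ C,
      (∀ c, c ≠ a → c ≠ b → p c = 0) → (∀ c, c ≠ a → c ≠ b → q c = 0) → p = q := by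
    intro d C hC p hp q hq hpe hqe
    obtain ⟨r, hr, rfl⟩ := isNormalDisc_iff.mp (S.isNormalDisc _ _ _ hC)
    rw [(separates_and_eq_of_mem_discCurve hr hp hab hpe).2,
      (separates_and_eq_of_mem_discCurve hr hq hab hqe).2]
  have himg : S.edgePoints t a b = g '' (F : Set (Σ _ : DiscType, Set (Fin 4 → ℝ))) := by
    ext p
    constructor
    · rintro ⟨hpe, d, C, hC, hp⟩
      obtain ⟨r, hr, hCr⟩ := isNormalDisc_iff.mp (S.isNormalDisc _ _ _ hC)
      have hsep := (separates_and_eq_of_mem_discCurve hr (hCr ▸ hp) hab hpe).1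
      have hx : (⟨d, C⟩ : Σ _ : DiscType, Set (Fin 4 → ℝ)) ∈ F := (hF _).mpr ⟨hsep, hC⟩
      exact ⟨⟨d, C⟩, hx, huniq d C hC _ (hg _ hx).1 _ hp (hg _ hx).2 hpe⟩
    · rintro ⟨x, hx, rfl⟩
      exact ⟨(hg x hx).2, x.1, x.2, ((hF x).mp hx).2, (hg x hx).1⟩
  rw [himg, Set.InjOn.ncard_image, Set.ncard_coe_finset, Finset.card_sigma, edgeCount,
    Finset.sum_filter]
  · push_cast
    rfl
  · intro x hx y hy hxy
    exact hdisj x hx y hy (g x) (hg x hx).1 (hxy ▸ (hg y hy).1)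

theorem NormalSurface.edgeCount_vec_eq (S : NormalSurface T) {t t' : Fin n} {f : Fin 4}
    {σ : Equiv.Perm (Fin 4)} (h : T.glue t f = some (t', σ)) {a b : Fin 4} (hab : a ≠ b)
    (haf : a ≠ f) (hbf : b ≠ f) :
    edgeCount (fun d => S.vec (t, d)) a b = edgeCount (fun d => S.vec (t', d)) (σ a) (σ b) := by
  rw [← S.ncard_edgePoints t hab, ← S.ncard_edgePoints t' (σ.injective.ne hab)]
  have himg : S.edgePoints t' (σ a) (σ b) =
      (fun (p : Fin 4 → ℝ) v => p (σ⁻¹ v)) '' S.edgePoints t a b := by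
    ext q
    constructor
    · rintro ⟨hqe, hq⟩
      have hqe' : ∀ c, c ≠ a → c ≠ b → q (σ c) = 0 := fun c hca hcb =>
        hqe _ (σ.injective.ne hca) (σ.injective.ne hcb)
      refine ⟨fun v => q (σ v), ⟨hqe', ?_⟩, by simp⟩
      rw [S.glue t f t' σ h _ (hqe' f haf.symm hbf.symm)]
      simpa using hq
    · rintro ⟨p, ⟨hpe, hp⟩, rfl⟩
      refine ⟨fun c hca hcb => hpe _ ?_ ?_, (S.glue t f t' σ h p (hpe f haf.symm hbf.symm)).mp hp⟩
      · rintro rfl; simp at hca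
      · rintro rfl; simp at hcb
  rw [himg, Set.ncard_image_of_injective]
  intro p q hpq
  funext v
  simpa using congrFun hpq (σ v)

/-- The gluing condition compares traces only as point sets, so the edge counts are matched first.
The three edge counts of a face determine its arc counts: twice the number of arcs around `a` is the
count on `ab` plus that on `ac` minus that on `bc`. -/
theorem NormalSurface.cutCount_vec_eq (S : NormalSurface T) {t t' : Fin n} {f : Fin 4}
    {σ : Equiv.Perm (Fin 4)} (h : T.glue t f = some (t', σ)) {a : Fin 4} (ha : a ≠ f) :
    cutCount (fun d => S.vec (t, d)) f a = cutCount (fun d => S.vec (t', d)) (σ f) (σ a) := by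
  obtain ⟨b, c, hab, hac, hbc, hbf, hcf⟩ : ∃ b c : Fin 4, a ≠ b ∧ a ≠ c ∧ b ≠ c ∧ b ≠ f ∧ c ≠ f := by
    clear h; revert a f; decide
  have h1 := S.edgeCount_vec_eq h hab ha hbf
  have h2 := S.edgeCount_vec_eq h hac ha hcf
  have h3 := S.edgeCount_vec_eq h hbc hbf hcf
  have hσ := fun {u v : Fin 4} (h : u ≠ v) => σ.injective.ne h
  rw [edgeCount_eq _ hab ha hbf, edgeCount_eq _ (hσ hab) (hσ ha) (hσ hbf)] at h1
  rw [edgeCount_eq _ hac ha hcf, edgeCount_eq _ (hσ hac) (hσ ha) (hσ hcf)] at h2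
  rw [edgeCount_eq _ hbc hbf hcf, edgeCount_eq _ (hσ hbc) (hσ hbf) (hσ hcf)] at h3
  linarith

end Admissible

/-! ### Realization of admissible vectors -/

section Realization

variable {X : DiscType → ℤ}

/-- The quadrilateral constraint in one tetrahedron. -/
def OneQuad (X : DiscType → ℤ) : Prop :=
  ∀ q q' : Fin 3, X (Sum.inr q) ≠ 0 → X (Sum.inr q') ≠ 0 → q = q'

/-- In the standard collection of discs with `X d` discs of type `d`, the number of arcs around the
vertex `a` between `a` and the `i`th disc of type `d`, if this disc cuts off `a` in some face. -/
def level (X : DiscType → ℤ) (d : DiscType) (i : ℤ) (a : Fin 4) : ℤ :=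
  match d with
  | Sum.inl _ => i
  | Sum.inr q => if DiscType.side (Sum.inr q) a then X (Sum.inl a) + i
      else X (Sum.inl a) + (X (Sum.inr q) - 1 - i)

/-- The position of the `k`th of the equally spaced corners on the edge `ab`. -/
noncomputable def levelPosition (X : DiscType → ℤ) (a b : Fin 4) (k : ℤ) : ℝ :=
  ((k : ℝ) + 1) / (edgeCount X a b + 1)

/-- The corner positions of the `i`th standard disc of type `d`. -/
noncomputable def standardPosition (X : DiscType → ℤ) (d : DiscType) (i : ℤ) (a b : Fin 4) : ℝ :=
  match d with
  | Sum.inl v => if a = v then levelPosition X a b i else 1 - levelPosition X b a i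
  | Sum.inr q => levelPosition X a b (level X (Sum.inr q) i a)

/-- The `i`th standard disc of type `d`. -/
noncomputable def standardDisc (X : DiscType → ℤ) (d : DiscType) (i : ℤ) : Set (Fin 4 → ℝ) :=
  discCurve d (standardPosition X d i)

theorem level_nonneg (hX : ∀ d, 0 ≤ X d) {d : DiscType} {i : ℤ} (hi : 0 ≤ i) (hid : i < X d)
    (a : Fin 4) : 0 ≤ level X d i a := by
  have := hX (Sum.inl a)
  rcases d with v | q
  · exact hi
  · rw [level]
    split_ifs <;> omega

/-- Together with `level_injective` and `exists_level_eq`, this numbers the arcs around `a` in a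
face from `0` to `cutCount X f a - 1`: triangles nearest to `a`, then the parallel quadrilaterals.
-/
theorem level_lt_cutCount {d : DiscType} {i : ℤ} (hX : ∀ d, 0 ≤ X d) (hi : 0 ≤ i) (hid : i < X d)
    {f a : Fin 4} (ha : a ≠ f) (hd : d.CutsOff f a) : level X d i a < cutCount X f a := by
  obtain ⟨q, hq⟩ := exists_cutsOff_iff ha
  rw [cutCount_eq X hq]
  have := hX (Sum.inr q)
  rcases (hq d).mp hd with rfl | rfl
  · rw [level]; omega
  · rw [level]; split_ifs <;> omega

theorem level_injective {d d' : DiscType} {i i' : ℤ} (hi : 0 ≤ i) (hid : i < X d)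
    (hi' : 0 ≤ i') (hid' : i' < X d') {f a : Fin 4} (ha : a ≠ f) (hd : d.CutsOff f a)
    (hd' : d'.CutsOff f a) (h : level X d i a = level X d' i' a) : d = d' ∧ i = i' := by
  obtain ⟨q, hq⟩ := exists_cutsOff_iff ha
  rcases (hq d).mp hd with rfl | rfl <;> rcases (hq d').mp hd' with rfl | rfl
  · exact ⟨rfl, h⟩
  · exfalso
    simp only [level] at h
    split_ifs at h <;> omega
  · exfalso
    simp only [level] at h
    split_ifs at h <;> omega
  · simp only [level] at h
    refine ⟨rfl, ?_⟩
    split_ifs at h <;> omega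

theorem exists_level_eq {f a : Fin 4} (ha : a ≠ f) {k : ℤ} (hk : 0 ≤ k)
    (hka : k < cutCount X f a) :
    ∃ d i, 0 ≤ i ∧ i < X d ∧ d.CutsOff f a ∧ level X d i a = k := by
  obtain ⟨q, hq⟩ := exists_cutsOff_iff ha
  rw [cutCount_eq X hq] at hka
  by_cases h : k < X (Sum.inl a)
  · exact ⟨Sum.inl a, k, hk, h, (hq _).mpr (Or.inl rfl), rfl⟩
  by_cases hs : DiscType.side (Sum.inr q) a
  · refine ⟨Sum.inr q, k - X (Sum.inl a), by omega, by omega, (hq _).mpr (Or.inr rfl), ?_⟩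
    rw [level, if_pos hs]; omega
  · refine ⟨Sum.inr q, X (Sum.inr q) - 1 - (k - X (Sum.inl a)), by omega, by omega,
      (hq _).mpr (Or.inr rfl), ?_⟩
    rw [level, if_neg hs]; omega

theorem separates_inl_iff {v a b : Fin 4} (hab : a ≠ b) :
    DiscType.Separates (Sum.inl v) a b ↔ v = a ∨ v = b := by
  revert v a b; decide

theorem edgeCount_nonneg (hX : ∀ d, 0 ≤ X d) (a b : Fin 4) : 0 ≤ edgeCount X a b :=
  Finset.sum_nonneg fun d _ => by split_ifs <;> simp [hX]

theorem le_edgeCount (hX : ∀ d, 0 ≤ X d) {d : DiscType} {a b : Fin 4} (h : d.Separates a b) :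
    X d ≤ edgeCount X a b := by
  have := Finset.single_le_sum (f := fun d : DiscType => if d.Separates a b then X d else 0)
    (fun d _ => by split_ifs <;> simp [hX]) (Finset.mem_univ d)
  rwa [if_pos h] at this

theorem edgeCount_of_quad (hquad : OneQuad X) {q : Fin 3} (hq : X (Sum.inr q) ≠ 0) {a b : Fin 4}
    (h : DiscType.Separates (Sum.inr q) a b) :
    edgeCount X a b = X (Sum.inl a) + X (Sum.inl b) + X (Sum.inr q) := by
  rw [edgeCount, Fintype.sum_sum_type]
  congr 1
  · rw [← Finset.sum_filter, show (Finset.univ.filter fun v : Fin 4 =>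
      DiscType.Separates (Sum.inl v) a b) = {a, b} by
        ext v; simp [separates_inl_iff h.ne], Finset.sum_pair h.ne]
  · rw [Finset.sum_eq_single q, if_pos h]
    · intro q' _ hq'
      rw [ite_eq_right_iff]
      intro _
      by_contra hne
      exact hq' (hquad q' q hne hq)
    · simp

/-- Parallel quadrilaterals are numbered in opposite orders from their two sides. As levels start at
`0`, this identity makes the positions seen from `a` and from `b` add up to `1`. -/
theorem level_add_level (hquad : OneQuad X) {q : Fin 3} (hq : X (Sum.inr q) ≠ 0) {a b : Fin 4}
    (h : DiscType.Separates (Sum.inr q) a b) (i : ℤ) :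
    level X (Sum.inr q) i a + level X (Sum.inr q) i b + 1 = edgeCount X a b := by
  have hs : DiscType.side (Sum.inr q) a ≠ DiscType.side (Sum.inr q) b := h
  rw [edgeCount_of_quad hquad hq h]
  simp only [level]
  cases ha : DiscType.side (Sum.inr q) a <;> cases hb : DiscType.side (Sum.inr q) b <;>
    simp_all <;> ring

theorem levelPosition_pos (hX : ∀ d, 0 ≤ X d) (a b : Fin 4) {k : ℤ} (hk : 0 ≤ k) :
    0 < levelPosition X a b k := by
  have h1 : (0 : ℝ) ≤ edgeCount X a b := by exact_mod_cast edgeCount_nonneg hX a b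
  have h2 : (0 : ℝ) ≤ k := by exact_mod_cast hk
  rw [levelPosition]
  positivity

theorem levelPosition_lt_one (hX : ∀ d, 0 ≤ X d) {a b : Fin 4} {k : ℤ} (hk : k < edgeCount X a b) :
    levelPosition X a b k < 1 := by
  have h1 : (0 : ℝ) ≤ edgeCount X a b := by exact_mod_cast edgeCount_nonneg hX a b
  have h2 : (k : ℝ) < edgeCount X a b := by exact_mod_cast hk
  rw [levelPosition, div_lt_one (by linarith)]
  linarith

theorem levelPosition_strictMono (hX : ∀ d, 0 ≤ X d) (a b : Fin 4) {k k' : ℤ} (hk : k < k') :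
    levelPosition X a b k < levelPosition X a b k' := by
  have h1 : (0 : ℝ) ≤ edgeCount X a b := by exact_mod_cast edgeCount_nonneg hX a b
  have h2 : (k : ℝ) < k' := by exact_mod_cast hk
  rw [levelPosition, levelPosition]
  gcongr

theorem isCornerPosition_standardPosition (hX : ∀ d, 0 ≤ X d) (hquad : OneQuad X) {d : DiscType}
    {i : ℤ} (hi : 0 ≤ i) (hid : i < X d) : IsCornerPosition d (standardPosition X d i) := by
  intro a b h
  have hM := le_edgeCount hX h
  rcases d with v | q
  · rcases (separates_inl_iff h.ne).mp h with rfl | rfl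
    · simp only [standardPosition, if_pos, if_neg h.ne.symm]
      exact ⟨levelPosition_pos hX _ _ hi, by ring⟩
    · simp only [standardPosition, if_pos, if_neg h.ne]
      rw [edgeCount_comm] at hM
      have := levelPosition_lt_one hX (a := v) (b := a) (k := i) (by omega)
      exact ⟨by linarith, by ring⟩
  · simp only [standardPosition]
    refine ⟨levelPosition_pos hX _ _ (level_nonneg hX hi hid a), ?_⟩
    have h1 : (0 : ℝ) ≤ edgeCount X a b := by exact_mod_cast edgeCount_nonneg hX a b
    rw [levelPosition, levelPosition, edgeCount_comm X b a, ← add_div, div_eq_one_iff_eq (by linarith)]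
    have := level_add_level hquad (q := q) (by omega) h i
    rw [← this]
    push_cast
    ring

theorem eq_of_cutsOff_inl {v : Fin 4} : ∀ {a f : Fin 4}, a ≠ f →
    DiscType.CutsOff (Sum.inl v) f a → a = v := by
  revert v; decide

theorem standardPosition_of_cutsOff {d : DiscType} {f a : Fin 4} (ha : a ≠ f)
    (hd : d.CutsOff f a) (i : ℤ) (b : Fin 4) :
    standardPosition X d i a b = levelPosition X a b (level X d i a) := by
  rcases d with v | q
  · simp [standardPosition, level, eq_of_cutsOff_inl ha hd]
  · rfl

/-- The trace of the standard discs on the face opposite `f`. -/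
def standardTrace (X : DiscType → ℤ) (f : Fin 4) : Set (Fin 4 → ℝ) :=
  {p | ∃ a b c, Distinct4 a b c f ∧ ∃ k : ℤ, 0 ≤ k ∧ k < cutCount X f a ∧
    p ∈ segment ℝ (edgePoint a b (levelPosition X a b k)) (edgePoint a c (levelPosition X a c k))}

theorem exists_arc_of_mem_standardDisc (hX : ∀ d, 0 ≤ X d) (hquad : OneQuad X) {d : DiscType}
    {i : ℤ} (hi : 0 ≤ i) (hid : i < X d) {p : Fin 4 → ℝ} (hp : p ∈ standardDisc X d i) {f : Fin 4}
    (hf : p f = 0) : ∃ a b c, Distinct4 a b c f ∧ d.CutsOff f a ∧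
      p ∈ segment ℝ (edgePoint a b (levelPosition X a b (level X d i a)))
        (edgePoint a c (levelPosition X a c (level X d i a))) := by
  obtain ⟨a, b, c, H, hb, hc, hp⟩ := exists_arc_of_mem_discCurve
    (isCornerPosition_standardPosition hX hquad hi hid) hp hf
  have hd := (cutsOff_iff d H).mpr ⟨hb, hc⟩
  have haf : a ≠ f := H.2.2.1
  rw [standardPosition_of_cutsOff haf hd, standardPosition_of_cutsOff haf hd] at hp
  exact ⟨a, b, c, H, hd, hp⟩

theorem mem_standardTrace_iff (hX : ∀ d, 0 ≤ X d) (hquad : OneQuad X) {p : Fin 4 → ℝ} {f : Fin 4}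
    (hf : p f = 0) :
    (∃ d i, 0 ≤ i ∧ i < X d ∧ p ∈ standardDisc X d i) ↔ p ∈ standardTrace X f := by
  constructor
  · rintro ⟨d, i, hi, hid, hp⟩
    obtain ⟨a, b, c, H, hd, hp⟩ := exists_arc_of_mem_standardDisc hX hquad hi hid hp hf
    exact ⟨a, b, c, H, _, level_nonneg hX hi hid a, level_lt_cutCount hX hi hid H.2.2.1 hd, hp⟩
  · rintro ⟨a, b, c, H, k, hk, hka, hp⟩
    have haf : a ≠ f := H.2.2.1
    obtain ⟨d, i, hi, hid, hd, rfl⟩ := exists_level_eq haf hk hka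
    have hsep := (cutsOff_iff d H).mp hd
    rw [← standardPosition_of_cutsOff haf hd, ← standardPosition_of_cutsOff haf hd] at hp
    exact ⟨d, i, hi, hid, a, b, c, H.2.2.2.1, hsep.1, hsep.2, hp⟩

/-- A common point lies on an arc of each disc in one face. Arcs around the same vertex are nested
by level, and arcs around different vertices are kept apart on their common edge, which has room for
all of them. -/
theorem eq_of_mem_standardDisc (hX : ∀ d, 0 ≤ X d) (hquad : OneQuad X) {d d' : DiscType}
    {i i' : ℤ} (hi : 0 ≤ i) (hid : i < X d) (hi' : 0 ≤ i') (hid' : i' < X d') {p : Fin 4 → ℝ}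
    (hp : p ∈ standardDisc X d i) (hp' : p ∈ standardDisc X d' i') : d = d' ∧ i = i' := by
  obtain ⟨f, hf⟩ := exists_face_of_mem_discCurve hp
  obtain ⟨a, b, c, H, hd, hp⟩ := exists_arc_of_mem_standardDisc hX hquad hi hid hp hf
  obtain ⟨a', b', c', H', hd', hp'⟩ := exists_arc_of_mem_standardDisc hX hquad hi' hid' hp' hf
  have haf : a ≠ f := H.2.2.1
  have hk := level_nonneg hX hi hid a
  have hk' := level_nonneg hX hi' hid' a'
  have hl := level_lt_cutCount hX hi hid haf hd
  have hl' := level_lt_cutCount hX hi' hid' H'.2.2.1 hd'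
  -- arcs around the same vertex
  have same : ∀ b' c', Distinct4 a b' c' f → a' = a →
      p ∈ segment ℝ (edgePoint a b' (levelPosition X a b' (level X d' i' a)))
        (edgePoint a c' (levelPosition X a c' (level X d' i' a))) → d = d' ∧ i = i' := by
    intro b' c' H' haa hp'
    subst haa
    refine level_injective hi hid hi' hid' haf hd hd' ?_
    have hp'' : p ∈ segment ℝ (edgePoint a' b (levelPosition X a' b (level X d' i' a')))
        (edgePoint a' c (levelPosition X a' c (level X d' i' a'))) := by
      have : (b' = b ∧ c' = c) ∨ (b' = c ∧ c' = b) := H.eq_or_eq H'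
      rcases this with ⟨rfl, rfl⟩ | ⟨rfl, rfl⟩
      · exact hp'
      · rw [segment_symm]; exact hp'
    by_contra hne
    rcases lt_or_gt_of_ne hne with hlt | hlt
    · exact disjoint_arcs_same H (levelPosition_pos hX _ _ hk) (levelPosition_pos hX _ _ hk)
        (levelPosition_strictMono hX _ _ hlt) (levelPosition_strictMono hX _ _ hlt) hp hp''
    · exact disjoint_arcs_same H (levelPosition_pos hX _ _ hk') (levelPosition_pos hX _ _ hk')
        (levelPosition_strictMono hX _ _ hlt) (levelPosition_strictMono hX _ _ hlt) hp'' hp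
  -- arcs around different vertices
  have diff : ∀ b c, Distinct4 a b c f → a' = b →
      p ∈ segment ℝ (edgePoint a b (levelPosition X a b (level X d i a)))
        (edgePoint a c (levelPosition X a c (level X d i a))) → False := by
    intro b c H hab hp
    subst hab
    have hp'' : p ∈ segment ℝ (edgePoint a' a (levelPosition X a' a (level X d' i' a')))
        (edgePoint a' c (levelPosition X a' c (level X d' i' a'))) := by
      have : (b' = a ∧ c' = c) ∨ (b' = c ∧ c' = a) := H.rotate.eq_or_eq H'
      rcases this with ⟨rfl, rfl⟩ | ⟨rfl, rfl⟩
      · exact hp'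
      · rw [segment_symm]; exact hp'
    obtain ⟨h1, h2, h3, h4, h5, h6⟩ := id H
    have hX' : ∀ v, 0 ≤ cutCount X f v := fun v =>
      Finset.sum_nonneg fun d _ => by split_ifs <;> simp [hX]
    have e1 := edgeCount_eq X h1 h3 h5
    have e2 := edgeCount_eq X h2 h3 h6
    have e3 := edgeCount_eq X h4 h5 h6
    have hc0 := hX' c
    refine disjoint_arcs_ne H (levelPosition_pos hX _ _ hk) (levelPosition_pos hX _ _ hk')
      (levelPosition_lt_one hX (by omega)) (levelPosition_lt_one hX (by omega)) ?_ hp hp''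
    have h1 : (0 : ℝ) ≤ edgeCount X a a' := by exact_mod_cast edgeCount_nonneg hX a a'
    rw [levelPosition, levelPosition, edgeCount_comm X a' a, ← add_div, div_lt_one (by linarith)]
    -- Each level is at most its arc count minus one, and the two arc counts add up to the edge
    -- count.
    have : (level X d i a + level X d' i' a' + 1 : ℤ) < edgeCount X a a' := by omega
    have : (level X d i a + level X d' i' a' + 1 : ℝ) < edgeCount X a a' := by exact_mod_cast this
    linarith
  rcases H.cover a' with h | h | h | h
  · subst h
    exact same b' c' H' rfl hp'
  · exact (diff b c H h hp).elim
  · exact (diff c b H.swap h (segment_symm ℝ (edgePoint a b _) _ ▸ hp)).elim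
  · exact absurd h H'.2.2.1

theorem standardDisc_nonempty (hX : ∀ d, 0 ≤ X d) (hquad : OneQuad X) {d : DiscType}
    {i : ℤ} (hi : 0 ≤ i) (hid : i < X d) : (standardDisc X d i).Nonempty := by
  obtain ⟨a, b, h⟩ : ∃ a b, d.Separates a b := by
    clear hid; revert d; decide
  exact ⟨_, edgePoint_mem_discCurve (isCornerPosition_standardPosition hX hquad hi hid) h⟩

/-- Corner positions on the edges of a face depend only on edge counts, hence on the arc counts of
that face, so the gluing map carries arcs to arcs of the same level. -/
theorem mem_standardTrace_of_glue {X X' : DiscType → ℤ} {f : Fin 4} {σ : Equiv.Perm (Fin 4)}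
    (h : ∀ v, v ≠ f → cutCount X f v = cutCount X' (σ f) (σ v)) {p : Fin 4 → ℝ}
    (hp : p ∈ standardTrace X f) : (fun v => p (σ⁻¹ v)) ∈ standardTrace X' (σ f) := by
  obtain ⟨a, b, c, H, k, hk, hka, hp⟩ := hp
  obtain ⟨h1, h2, h3, h4, h5, h6⟩ := id H
  have hσ := fun {u v : Fin 4} (h : u ≠ v) => σ.injective.ne h
  have Hσ : Distinct4 (σ a) (σ b) (σ c) (σ f) := ⟨hσ h1, hσ h2, hσ h3, hσ h4, hσ h5, hσ h6⟩
  refine ⟨σ a, σ b, σ c, Hσ, k, hk, h a h3 ▸ hka, ?_⟩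
  have hpos : ∀ v, a ≠ v → v ≠ f →
      levelPosition X' (σ a) (σ v) k = levelPosition X a v k := by
    intro v hav hvf
    rw [levelPosition, levelPosition, edgeCount_eq X hav h3 hvf,
      edgeCount_eq X' (hσ hav) (hσ h3) (hσ hvf), h a h3, h v hvf]
  rw [mem_segment_edgePoint_iff Hσ, hpos b h1 h5, hpos c h2 h6]
  simpa using (mem_segment_edgePoint_iff H).mp hp

/-- Every admissible vector is the vector representation of a normal surface. -/
theorem exists_normalSurface {n : ℕ} (T : Triangulation n) {x : Coord n → ℤ} (hx : 0 ≤ x)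
    (hquad : QuadConstraints x)
    (hmatch : ∀ t f t' σ, T.glue t f = some (t', σ) → ∀ v, v ≠ f →
      cutCount (fun d => x (t, d)) f v = cutCount (fun d => x (t', d)) (σ f) (σ v)) :
    ∃ S : NormalSurface T, S.vec = x := by
  classical
  have hX : ∀ t d, 0 ≤ x (t, d) := fun t d => hx (t, d)
  have hQ : ∀ t, OneQuad fun d => x (t, d) := fun t => hquad t
  have hmem : ∀ (t : Fin n) (p : Fin 4 → ℝ),
      (∃ d, ∃ C ∈ (Finset.Ico 0 (x (t, d))).image (standardDisc (fun d => x (t, d)) d), p ∈ C) ↔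
        ∃ d i, 0 ≤ i ∧ i < x (t, d) ∧ p ∈ standardDisc (fun d => x (t, d)) d i := by
    intro t p
    simp [and_assoc]
  refine ⟨⟨fun t d => (Finset.Ico 0 (x (t, d))).image (standardDisc (fun d => x (t, d)) d),
    fun t d C hC => ?_, fun t d d' C hC C' hC' hne => ?_, fun t f t' σ hglue p hpf => ?_⟩, ?_⟩
  · obtain ⟨i, hi, rfl⟩ := Finset.mem_image.mp hC
    rw [Finset.mem_Ico] at hi
    exact isNormalDisc_iff.mpr ⟨_, isCornerPosition_standardPosition (hX t) (hQ t) hi.1 hi.2, rfl⟩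
  · obtain ⟨i, hi, rfl⟩ := Finset.mem_image.mp hC
    obtain ⟨i', hi', rfl⟩ := Finset.mem_image.mp hC'
    rw [Finset.mem_Ico] at hi hi'
    refine Set.disjoint_left.mpr fun p hp hp' => ?_
    obtain ⟨rfl, rfl⟩ := eq_of_mem_standardDisc (hX t) (hQ t) hi.1 hi.2 hi'.1 hi'.2 hp hp'
    simp at hne
  · rw [hmem, hmem, mem_standardTrace_iff (hX t) (hQ t) hpf,
      mem_standardTrace_iff (hX t') (hQ t') (f := σ f) (by simpa using hpf)]
    refine ⟨mem_standardTrace_of_glue (hmatch t f t' σ hglue), fun hp => ?_⟩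
    have hglue' := T.glue_symm t f t' σ hglue
    simpa using mem_standardTrace_of_glue (hmatch t' (σ f) t σ⁻¹ hglue') hp
  · funext ⟨t, d⟩
    simp only [NormalSurface.vec]
    -- No disc is lost in the image: equal discs share a point, since discs are non-empty, and so
    -- have the same index.
    rw [Finset.card_image_of_injOn, Int.card_Ico, sub_zero, Int.toNat_of_nonneg (hX t d)]
    intro i hi i' hi' h
    rw [Finset.mem_coe, Finset.mem_Ico] at hi hi'
    obtain ⟨p, hp⟩ := standardDisc_nonempty (hX t) (hQ t) hi.1 hi.2
    exact (eq_of_mem_standardDisc (hX t) (hQ t) hi.1 hi.2 hi'.1 hi'.2 hp (h ▸ hp)).2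

end Realization

/-! ### The main theorem -/

section Main

variable {n : ℕ} (T : Triangulation n)

theorem matchingMatrix_dotProduct_eq_zero_iff (x : Coord n → ℤ) :
    (∀ r, T.matchingMatrix r ⬝ᵥ x = 0) ↔
      ∀ t f t' σ, T.glue t f = some (t', σ) → ∀ v, v ≠ f →
        cutCount (fun d => x (t, d)) f v = cutCount (fun d => x (t', d)) (σ f) (σ v) := by
  constructor
  · intro hx
    have key : ∀ t f t' σ, T.glue t f = some (t', σ) → toLex (t, f) < toLex (t', σ f) →
        ∀ v, v ≠ f → cutCount (fun d => x (t, d)) f v = cutCount (fun d => x (t', d)) (σ f) (σ v) := by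
      intro t f t' σ hglue hlt v hv
      obtain ⟨j, rfl⟩ := Fin.exists_succAbove_eq hv
      have := hx (⟨(t, f), t', σ, hglue, hlt⟩, j)
      rw [Triangulation.matchingMatrix, matchingEquation_dotProduct T hglue] at this
      exact sub_eq_zero.mp this
    intro t f t' σ hglue v hv
    -- The matrix has rows for only one side of each glued pair; the equation from the other side is
    -- the same one read through `σ⁻¹`.
    rcases lt_trichotomy (toLex (t, f)) (toLex (t', σ f)) with hlt | heq | hlt
    · exact key t f t' σ hglue hlt v hv
    · exact absurd (toLex.injective heq).symm (T.glue_ne t f t' σ hglue)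
    · have := key t' (σ f) t σ⁻¹ (T.glue_symm t f t' σ hglue) (by simpa using hlt) (σ v)
        (σ.injective.ne hv)
      simpa using this.symm
  · rintro hx ⟨⟨⟨t, f⟩, t', σ, hglue, hlt⟩, j⟩
    rw [Triangulation.matchingMatrix, matchingEquation_dotProduct T hglue, sub_eq_zero]
    exact hx t f t' σ hglue _ (Fin.succAbove_ne f j)

/-- Haken's characterization of the vector representations of normal surfaces. -/
theorem exists_vec_eq_iff (order : Fin (3 * T.numInternalFaces) ≃ T.InternalFace × Fin 3)
    (x : Coord n → ℤ) : (∃ S : NormalSurface T, S.vec = x) ↔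
      x ∈ intPoints (partialCone (T.matchingMatrix.submatrix order id) (3 * T.numInternalFaces)) ∧
        QuadConstraints x := by
  have hrows : x ∈ intPoints (partialCone (T.matchingMatrix.submatrix order id)
      (3 * T.numInternalFaces)) ↔ (∀ r, T.matchingMatrix r ⬝ᵥ x = 0) ∧ 0 ≤ x := by
    rw [mem_intPoints_partialCone]
    refine and_congr_left fun _ => ⟨fun h r => ?_, fun h i _ => h (order i)⟩
    have := h (order.symm r) (Fin.is_lt _)
    rw [← order.apply_symm_apply r]
    exact this
  rw [hrows, matchingMatrix_dotProduct_eq_zero_iff]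
  constructor
  · rintro ⟨S, rfl⟩
    exact ⟨⟨fun t f t' σ h v hv => S.cutCount_vec_eq h hv, S.vec_nonneg⟩, S.quadConstraints_vec⟩
  · rintro ⟨⟨hmatch, h0⟩, hquad⟩
    exact exists_normalSurface T h0 hquad hmatch

end Main

end NormalSurfaces

theorem mainTheorem2 {n : ℕ} (T : Triangulation n)
    (order : Fin (3 * T.numInternalFaces) ≃ T.InternalFace × Fin 3) :
    (∀ k : Fin (3 * T.numInternalFaces + 1),
      ∃ B ∈ candidateBasis (T.matchingMatrix.submatrix order id) k,
        (B : Set (Coord n → ℤ)) =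
          {x | x ∈ hilb (partialCone (T.matchingMatrix.submatrix order id) k) ∧
            QuadConstraints x}) ∧
    (∃ B ∈ candidateBasis (T.matchingMatrix.submatrix order id)
        (Fin.last (3 * T.numInternalFaces)),
      (B : Set (Coord n → ℤ)) = {x | ∃ S : NormalSurface T, S.IsFundamental ∧ S.vec = x}) := by
  refine ⟨exists_mem_candidateBasis _, ?_⟩
  obtain ⟨B, hB, hBeq⟩ := exists_mem_candidateBasis (T.matchingMatrix.submatrix order id)
    (Fin.last (3 * T.numInternalFaces))
  refine ⟨B, hB, hBeq.trans ?_⟩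
  have hvec := exists_vec_eq_iff T order
  have hcone := isIntCone_intPoints_partialCone (T.matchingMatrix.submatrix order id)
    (3 * T.numInternalFaces)
  ext x
  constructor
  · rintro ⟨⟨hx, hx0, hirr⟩, hq⟩
    obtain ⟨S, rfl⟩ := (hvec x).mpr ⟨hx, hq⟩
    exact ⟨S, ⟨hx0, fun U V hUV => hirr _ ((hvec _).mp ⟨U, rfl⟩).1 _ ((hvec _).mp ⟨V, rfl⟩).1 hUV⟩,
      rfl⟩
  · rintro ⟨S, ⟨hS0, hS⟩, rfl⟩
    have hSv := (hvec _).mp ⟨S, rfl⟩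
    refine ⟨⟨hSv.1, hS0, fun y hy z hz hyz => ?_⟩, hSv.2⟩
    -- Irreducibility concerns all splittings in the cone, fundamentality only those into normal
    -- surfaces. They agree because summands of an admissible vector are admissible and hence
    -- realized by surfaces.
    have hyq : QuadConstraints y := hSv.2.of_le (hcone.nonneg y hy)
      (hyz ▸ le_add_of_nonneg_right (hcone.nonneg z hz))
    have hzq : QuadConstraints z := hSv.2.of_le (hcone.nonneg z hz)
      (hyz ▸ le_add_of_nonneg_left (hcone.nonneg y hy))
    obtain ⟨U, rfl⟩ := (hvec y).mpr ⟨hy, hyq⟩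
    obtain ⟨V, rfl⟩ := (hvec z).mpr ⟨hz, hzq⟩
    exact hS U V hyz
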